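/- **Setting.** Let $f:\mathbb{R}^n\to\mathbb{R}$ be $C^1$, let $\lambda>0$, $p\in(0,1)$, $\mu\in(0,1)$, $\delta<1$, $0<\ell\le L<\infty$, and let $s_1,\dots,s_m$ be disjoint sets of indices with union $\{1,\dots,n\}$. Write $x_{s}$ for the coordinates of $x$ in $s$, and $(x_{\ne s},u)$ for $x$ with $x_s$ replaced by $u$. For $x,\varepsilon\in\mathbb{R}^n$ put $$F(x,\varepsilon)=f(x)+\lambda\sum_{i=1}^n(|x_i|+\varepsilon_i^2)^p .$$ Assume that $F(\cdot,0)$ is coercive ($F(x,0)\to+\infty$ as $\|x\|\to+\infty$) and that for each block $s_i$ there is $L_i\in[\ell,L]$ such that $\|\nabla_{s_i}f(x)-\nabla_{s_i}f(\hat x)\|\le L_i\|x_{s_i}-\hat x_{s_i}\|$ whenever $x$ and $\hat x$ differ only in the block $s_i$. **Algorithm (BPIREe-$\ell_p$).** Start from $x^0=x^{-1}\in\mathbb{R}^n$ and $\varepsilon^0\in\mathbb{R}^n_{++}$. In iteration $k\ge1$ a block $b_k\in\{s_1,\dots,s_m\}$ is selected (in any manner), and $x^k_{s}=x^{k-1}_{s}$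 for the blocks $s\ne b_k$. For $s=b_k$, $$x^k_{s}=\arg\min_{u}\Big\{\langle\nabla_{s}f(x^{k-1}_{\ne s},\hat x^k_{s}),u\rangle+\frac1{2\alpha_k}\|u-\hat x^k_{s}\|^2+\sum_{j\in s}w^{k-1}_j|u_j|\Big\},\qquad w^{k-1}_j=\lambda p\big(|x^{k-1}_j|+(\varepsilon^{k-1}_j)^2\big)^{p-1},$$ $$\hat x^k_{s}=x^{k-1}_{s}+\beta_k(x^{k-1}_{s}-x^{\rm prev}_{s}),\qquad \alpha_k=\frac1{2L_k},$$ where $x^{\rm prev}_{s}$ is the value that the block $s$ had just before its last update prior to iteration $k$ (and $x^{\rm prev}_s=x^0_s$ if there was none), and $L_k\in[\ell,L]$ is a Lipschitz constant of $u\mapsto\nabla_{s}f(x^{k-1}_{\ne s},u)$. The extrapolation parameters satisfy $0\le\beta_k\le1$ and, whenever $b_k$ was updated before, $\beta_k\le\frac\delta6\sqrt{L_\kappa/L_k}$, where $\kappa<k$ is the last iteration before $k$ with $b_\kappa=b_k$. Then $\varepsilon^k\in\mathbb{R}^n_{++}$ is chosen such that, for every $i$, $$\varepsilon^k_i=\varepsilon^{k-1}_i\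 \text{ if }x^k_i=0,\qquad \varepsilon^k_i\le\sqrt\mu\,\varepsilon^{k-1}_i\ \text{ if }x^k_i\ne0 .$$ Assume that for some $T\ge m$ every block is updated at least once within any $T$ consecutive iterations, and that the parameters $\beta_k$ are chosen such that $F(x^k,\varepsilon^k)\le F(x^{k-1},\varepsilon^{k-1})$ for all $k\ge1$. **KL property.** The Fréchet subdifferential $\hat\partial J(x)$ of $J:\mathbb{R}^N\to\mathbb{R}$ is the set of $u$ with $\liminf_{y\to x,\,y\ne x}\frac{J(y)-J(x)-\langle u,y-x\rangle}{\|y-x\|}\ge0$, and $\partial J(x)$ is the set of limits of $u^k\in\hat\partial J(y^k)$ with $y^k\to x$, $J(y^k)\to J(x)$. $J$ has the KL property at $\bar x$, where $\partial J(\bar x)\neq\emptyset$, if there are a neighborhood $U$ of $\bar x$, $\xi\in(0,+\infty]$ and $\varphi:[0,\xi)\to\mathbb{R}_+$ with $\varphi(0)=0$, $\varphi\in C^1(0,\xi)$, $\varphi'>0$ on $(0,\xi)$, such that $\varphi'(J(x)-J(\bar x))\,{\rm dist}(0,\partial J(x))\ge1$ for all $x\in U$ with $J(\bar x)<J(x)<J(\bar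 x)+\xi$. **Theorem.** Let $x^*$ be a limit point (cluster point) of $\{x^k\}$, and let $\mathcal I^*=\{i:x^*_i\ne0\}$. Assume that for some $\rho>0$ and $L_G$, for each block $s_i$, $$\|\nabla_{s_i}f(y)-\nabla_{s_i}f(z)\|\le L_G\|y-z\|\qquad\text{for all }y,z\text{ with }\|y-x^*\|<4\rho,\ \|z-x^*\|<4\rho,$$ and that the reduced function $$(x_{\mathcal I^*},\varepsilon_{\mathcal I^*})\mapsto f(x_{\mathcal I^*},0)+\lambda\sum_{i\in\mathcal I^*}(|x_i|+\varepsilon_i^2)^p$$ on $\mathbb{R}^{2|\mathcal I^*|}$ (the coordinates of $x$ outside $\mathcal I^*$ being set to $0$) has the KL property at $(x^*_{\mathcal I^*},0)$. Then $\{i:x^k_i\ne0\}=\mathcal I^*$ for all sufficiently large $k$, and the whole sequence converges: $\lim_{k\to+\infty}x^k=x^*$. -/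

import Mathlib

open Filter Topology

noncomputable section

namespace BPIRE

/-! ### Subdifferentials and the Kurdyka-Lojasiewicz property -/

section KL

variable {E : Type*} [NormedAddCommGroup E] [InnerProductSpace ℝ E]

/-- The Fréchet subdifferential of a finite-valued function `J` at `x`: the vectors `u` with
`liminf_{y → x, y ≠ x} (J y - J x - ⟪u, y - x⟫) / ‖y - x‖ ≥ 0`, written out with `η`. -/
def frechetSubdiff (J : E → ℝ) (x : E) : Set E :=
  {u | ∀ η : ℝ, 0 < η → ∀ᶠ y in 𝓝 x, -(η * ‖y - x‖) ≤ J y - J x - inner ℝ u (y - x)}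

/-- The limiting subdifferential. -/
def limitingSubdiff (J : E → ℝ) (x : E) : Set E :=
  {u | ∃ (y : ℕ → E) (v : ℕ → E),
    Tendsto y atTop (𝓝 x) ∧ Tendsto (fun k => J (y k)) atTop (𝓝 (J x)) ∧
    (∀ k, v k ∈ frechetSubdiff J (y k)) ∧ Tendsto v atTop (𝓝 u)}

/-- The Kurdyka-Lojasiewicz property of `J` at `xb`. The distance from `0` to the subdifferential
is the extended one (it is `∞` where the subdifferential is empty). -/
def HasKLProperty (J : E → ℝ) (xb : E) : Prop :=
  (limitingSubdiff J xb).Nonempty ∧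
  ∃ U ∈ 𝓝 xb, ∃ ξ : EReal, 0 < ξ ∧ ∃ φ : ℝ → ℝ,
    (∀ s : ℝ, 0 ≤ s → (s : EReal) < ξ → 0 ≤ φ s) ∧
    φ 0 = 0 ∧
    ContDiffOn ℝ 1 φ {s : ℝ | 0 < s ∧ (s : EReal) < ξ} ∧
    (∀ s : ℝ, 0 < s → (s : EReal) < ξ → 0 < deriv φ s) ∧
    ∀ x ∈ U, J xb < J x → (J x : EReal) < (J xb : EReal) + ξ →
      1 ≤ ENNReal.ofReal (deriv φ (J x - J xb)) * Metric.infEDist 0 (limitingSubdiff J x)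

end KL

/-! ### The problem

The blocks `s_1, …, s_m` are encoded by the map `blk : Fin n → Fin m` that sends a coordinate to
the block containing it. -/

/-- The vector `v` with all coordinates outside block `i` set to `0` (it has the norm of `v_{s_i}`). -/
def blockPart {n m : ℕ} (blk : Fin n → Fin m) (i : Fin m) (v : EuclideanSpace ℝ (Fin n)) :
    EuclideanSpace ℝ (Fin n) :=
  WithLp.toLp 2 fun j => if blk j = i then v j else 0

/-- `c` is a Lipschitz constant of `u ↦ ∇_{s_i} f (x_{≠ s_i}, u)`. -/
def IsBlockLipschitzAt {n m : ℕ} (f : EuclideanSpace ℝ (Fin n) → ℝ) (blk : Fin n → Fin m)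
    (i : Fin m) (x : EuclideanSpace ℝ (Fin n)) (c : ℝ) : Prop :=
  ∀ y z : EuclideanSpace ℝ (Fin n),
    (∀ j, blk j ≠ i → y j = x j) → (∀ j, blk j ≠ i → z j = x j) →
    ‖blockPart blk i (gradient f y - gradient f z)‖ ≤ c * ‖blockPart blk i (y - z)‖

/-- `F(x, ε) = f(x) + lam * ∑ i, (|x_i| + ε_i ^ 2) ^ p`. -/
def objective {n : ℕ} (f : EuclideanSpace ℝ (Fin n) → ℝ) (lam p : ℝ)
    (x : EuclideanSpace ℝ (Fin n)) (ε : Fin n → ℝ) : ℝ :=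
  f x + lam * ∑ i, (|x i| + ε i ^ 2) ^ p

/-- The standing assumption on the loss `f` and on the `ℓ_p` objective `F(·, 0)`: `f` is `C¹`, each
block gradient is Lipschitz in its own block, uniformly in the other blocks, with a constant in
`[ℓ, L]`, and the objective is coercive. -/
structure ProblemAssumption {n m : ℕ} (f : EuclideanSpace ℝ (Fin n) → ℝ) (blk : Fin n → Fin m)
    (lam p ℓ L : ℝ) : Prop where
  contDiff : ContDiff ℝ 1 f
  pos : 0 < ℓ
  block_lipschitz : ∀ i, ∃ c, ℓ ≤ c ∧ c ≤ L ∧ ∀ x, IsBlockLipschitzAt f blk i x c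
  coercive : Tendsto (fun x => objective f lam p x 0) (Bornology.cobounded _) atTop

/-! ### The algorithm -/

/-- The last iteration `κ` in `{1, …, k}` at which block `i` was updated, and `0` if there is none. -/
def lastUpdate {m : ℕ} (b : ℕ → Fin m) (i : Fin m) (k : ℕ) : ℕ :=
  Nat.findGreatest (fun κ => 1 ≤ κ ∧ b κ = i) k

/-- The point `(x^k_{≠ b_{k+1}}, x̂^{k+1}_{b_{k+1}})` at which the gradient is taken in iteration
`k + 1`. The selected block is extrapolated along `x^k - x^prev`, where `x^prev` is the value that the
block had before its last update, the one at iteration `κ = lastUpdate b (b (k + 1)) k`, that is,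
`x (κ - 1)`. If the block was never updated, then `κ = 0`, and `x (0 - 1) = x 0` is the right value, by
the initialization `x^{-1} = x^0`. -/
def extrapolated {n m : ℕ} (blk : Fin n → Fin m) (b : ℕ → Fin m) (β : ℕ → ℝ)
    (x : ℕ → EuclideanSpace ℝ (Fin n)) (k : ℕ) : EuclideanSpace ℝ (Fin n) :=
  x k + β (k + 1) • blockPart blk (b (k + 1)) (x k - x (lastUpdate b (b (k + 1)) k - 1))

/-- The weight `w_j = lam * p * (|x_j| + ε_j ^ 2) ^ (p - 1)`. -/
def weight {n : ℕ} (lam p : ℝ) (x : EuclideanSpace ℝ (Fin n)) (ε : Fin n → ℝ) (j : Fin n) : ℝ :=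
  lam * (p * (|x j| + ε j ^ 2) ^ (p - 1))

/-- The objective of the subproblem for block `i`, with gradient point `y`, step size `α` and
weights `w`; it depends only on the coordinates of `u` in block `i`:
`⟨∇_{s_i} f(y), u_{s_i}⟩ + ‖u_{s_i} - y_{s_i}‖² / (2 α) + ∑_{j ∈ s_i} w_j |u_j|`. -/
def subproblem {n m : ℕ} (f : EuclideanSpace ℝ (Fin n) → ℝ) (blk : Fin n → Fin m) (i : Fin m)
    (y : EuclideanSpace ℝ (Fin n)) (α : ℝ) (w : Fin n → ℝ) (u : EuclideanSpace ℝ (Fin n)) : ℝ :=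
  inner ℝ (blockPart blk i (gradient f y)) u + 1 / (2 * α) * ‖blockPart blk i (u - y)‖ ^ 2 +
    ∑ j with blk j = i, w j * |u j|

/-- `(x^k, ε^k)_{k ≥ 0}` is generated by the block proximal iteratively reweighted algorithm with
extrapolation for `ℓ_p` regularization. In iteration `k ≥ 1` the block `b k` is updated, with
extrapolation parameter `β k`, Lipschitz constant `Lk k` and step size `1 / (2 * Lk k)`. -/
structure IsBPIREeLp {n m : ℕ} (f : EuclideanSpace ℝ (Fin n) → ℝ) (blk : Fin n → Fin m)
    (lam p ℓ L δ μ : ℝ) (b : ℕ → Fin m) (β Lk : ℕ → ℝ)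
    (x : ℕ → EuclideanSpace ℝ (Fin n)) (ε : ℕ → Fin n → ℝ) : Prop where
  eps_pos : ∀ k i, 0 < ε k i
  /-- `Lk (k + 1)` is a Lipschitz constant of the gradient of the selected block, the other blocks
  being fixed at their current values. -/
  lip_const : ∀ k, ℓ ≤ Lk (k + 1) ∧ Lk (k + 1) ≤ L ∧
    IsBlockLipschitzAt f blk (b (k + 1)) (x k) (Lk (k + 1))
  beta_mem : ∀ k, 0 ≤ β (k + 1) ∧ β (k + 1) ≤ 1
  /-- The bound `δ / 6 * √(L̃^{j-1} / L̃^j)`, from the second update of the block on; at its first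
  update there is no `L̃^{j-1}`, and `β` has no effect. -/
  beta_le : ∀ k, 1 ≤ lastUpdate b (b (k + 1)) k →
    β (k + 1) ≤ δ / 6 * √(Lk (lastUpdate b (b (k + 1)) k) / Lk (k + 1))
  unselected : ∀ k j, blk j ≠ b (k + 1) → x (k + 1) j = x k j
  selected : ∀ k, ∀ u : EuclideanSpace ℝ (Fin n),
    subproblem f blk (b (k + 1)) (extrapolated blk b β x k) (1 / (2 * Lk (k + 1)))
        (weight lam p (x k) (ε k)) (x (k + 1)) ≤
      subproblem f blk (b (k + 1)) (extrapolated blk b β x k) (1 / (2 * Lk (k + 1)))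
        (weight lam p (x k) (ε k)) u
  eps_of_eq_zero : ∀ k i, x (k + 1) i = 0 → ε (k + 1) i = ε k i
  eps_of_ne_zero : ∀ k i, x (k + 1) i ≠ 0 → ε (k + 1) i ≤ √μ * ε k i

/-- Essentially cyclic block update: among any `T` consecutive iterations (`T ≥ m`) every block is
updated at least once. -/
def EssentiallyCyclic {m : ℕ} (b : ℕ → Fin m) (T : ℕ) : Prop :=
  m ≤ T ∧ ∀ (i : Fin m) (k : ℕ), ∃ κ ∈ Finset.Icc (k + 1) (k + T), b κ = i

/-! ### The reduced function -/

/-- The set of indices of nonzero coordinates. -/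
def nonzeroIdx {n : ℕ} (x : EuclideanSpace ℝ (Fin n)) : Finset (Fin n) :=
  Finset.univ.filter fun i => x i ≠ 0

/-- The reduced function `(x_I, ε_I) ↦ F(x_I, ε_I)` on `ℝ^{2|I|}`, the coordinates outside `I` being
fixed at zero: `Sum.inl i` is the coordinate of `x_i`, and `Sum.inr i` is that of `ε_i`. -/
def reducedObjective {n : ℕ} (f : EuclideanSpace ℝ (Fin n) → ℝ) (lam p : ℝ) (I : Finset (Fin n))
    (z : EuclideanSpace ℝ (I ⊕ I)) : ℝ :=
  f (WithLp.toLp 2 fun i => if h : i ∈ I then z (Sum.inl ⟨i, h⟩) else 0) +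
    lam * ∑ i : I, (|z (Sum.inl i)| + z (Sum.inr i) ^ 2) ^ p

/-- The point `(x_I, 0_I)` of `ℝ^{2|I|}`. -/
def reducedPoint {n : ℕ} (I : Finset (Fin n)) (x : EuclideanSpace ℝ (Fin n)) :
    EuclideanSpace ℝ (I ⊕ I) :=
  WithLp.toLp 2 (Sum.elim (fun i => x i) fun _ => 0)

end BPIRE

end

/-!
# Convergence of the block proximal iteratively reweighted algorithm with extrapolation

**Support.** Strong convexity of the subproblem, the block descent lemma and the concavity of
`s ↦ s ^ p` give a descent estimate in which the extrapolation costs at most an eighth of the quadratic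
gain of the previous update of the same block (`IsBPIREeLp.descent`). With coercivity, the iterates
are bounded and the steps tend to zero (`IsBPIREeLp.tendsto_scaledStep`). At a coordinate that is
nonzero after an update, optimality balances the weight `lam * p * (|x_j| + ε_j ^ 2) ^ (p - 1)` by a
bounded gradient, so `|x_j| + ε_j ^ 2` was bounded away from zero before the update
(`IsBPIREeLp.exists_lower_bound`); and `ε_j → 0` if this happens infinitely often. Hence the
coordinates are eventually either zero or bounded away from zero, and since the steps vanish the
support is eventually constant (`eventually_nonzeroIdx_eq`).

**Convergence.** From then on the objective is, up to a constant, the reduced function `J` at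
`z^k = (x^k_I, ε^k_I)`, which is differentiable near the limit. Its gradient is bounded, on the whole
segment from `z^k` to `z^{k+1}`, by a constant times `A_k`, the length of the recent path plus a
geometrically decaying term (`IsBPIREeLp.exists_norm_reducedGradient_le`). All values of `J` between
`J(z^{k+1})` and `J(z^k)` are attained on the segment, so the Kurdyka-Lojasiewicz inequality bounds
`φ'` from below between these levels, and the mean value inequality gives
`J(z^k) - J(z^{k+1}) ≤ C * A_k * (φ_k - φ_{k+1})`. This replaces the usual argument, for which `φ`
would have to be concave (`HasKLProperty.exists_desingularizing`). After taking square roots in the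
descent estimate, the new step, scaled by `√(L_k)`, is at most half the previous scaled step of the
same block, plus a small multiple of `A_k`, plus a telescoping term. Summation (`sum_steps_le`) bounds the length of the path
for as long as the iterates stay near the cluster point, so they stay there forever and converge
(`tendsto_of_trapped`).
-/

namespace BPIRE

/-! ### Consequences of the Kurdyka-Lojasiewicz inequality -/

section KL

variable {E : Type*} [NormedAddCommGroup E] [InnerProductSpace ℝ E]

lemma mem_limitingSubdiff_of_hasFDerivAt {J : E → ℝ} {x g : E}
    (h : HasFDerivAt J (innerSL ℝ g) x) : g ∈ limitingSubdiff J x := by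
  refine ⟨fun _ => x, fun _ => g, tendsto_const_nhds, tendsto_const_nhds, fun _ => ?_,
    tendsto_const_nhds⟩
  intro η hη
  filter_upwards [(hasFDerivAt_iff_isLittleO.1 h).def hη] with y hy
  rw [Real.norm_eq_abs] at hy
  simpa using (abs_le.1 hy).1

/-- The form in which the Kurdyka-Lojasiewicz inequality is used. No concavity or continuity of
`φ` is needed, because slopes are controlled at every level between `t` and `s`, and not only at
the level `s`. The function `ψ` is `φ - φ(0+)` on the positive axis. -/
lemma HasKLProperty.exists_desingularizing {J : E → ℝ} {xb : E} (h : HasKLProperty J xb) :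
    ∃ r > 0, ∃ ξ > 0, ∃ ψ : ℝ → ℝ, (∀ s, 0 ≤ s → s < ξ → 0 ≤ ψ s) ∧
      Tendsto ψ (𝓝[≥] 0) (𝓝 0) ∧
      ∀ t s M, 0 ≤ t → t ≤ s → s < ξ → 0 < M →
        (∀ τ ∈ Set.Ioo t s, ∃ z ∈ Metric.ball xb r, ∃ g : E, J z = J xb + τ ∧
          HasFDerivAt J (innerSL ℝ g) z ∧ ‖g‖ ≤ M) →
        s - t ≤ M * (ψ s - ψ t) := by
  obtain ⟨-, U, hU, ξ, hξ, φ, hφ0, -, hφd, hφ', hKL⟩ := h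
  obtain ⟨r, hr, hrU⟩ := Metric.mem_nhds_iff.1 hU
  obtain ⟨ξ', hξ'0, hξ'⟩ : ∃ ξ' : ℝ, 0 < ξ' ∧ (ξ' : EReal) < ξ := by
    obtain ⟨c, hc0, hc⟩ := EReal.lt_iff_exists_real_btwn.1 hξ
    exact ⟨c, by exact_mod_cast hc0, hc⟩
  have hlt : ∀ s : ℝ, s < ξ' → (s : EReal) < ξ := fun s hs =>
    lt_trans (by exact_mod_cast hs) hξ'
  have hopen : IsOpen {s : ℝ | 0 < s ∧ (s : EReal) < ξ} :=
    (isOpen_lt continuous_const continuous_id).inter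
      (isOpen_lt continuous_coe_real_ereal continuous_const)
  have hdiff : ∀ s : ℝ, 0 < s → s < ξ' → DifferentiableAt ℝ φ s := fun s h0 h1 =>
    (hφd.differentiableOn one_ne_zero).differentiableAt (hopen.mem_nhds ⟨h0, hlt s h1⟩)
  -- the mean value inequality on a compact interval of positive levels
  have hmv : ∀ t s c : ℝ, 0 < t → t ≤ s → s < ξ' → (∀ τ ∈ Set.Ioo t s, c ≤ deriv φ τ) →
      c * (s - t) ≤ φ s - φ t := by
    intro t s c h0 hts hs hc
    refine (convex_Icc t s).mul_sub_le_image_sub_of_le_deriv (f := φ) ?_ ?_ ?_ t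
      (Set.left_mem_Icc.2 hts) s (Set.right_mem_Icc.2 hts) hts
    · exact fun u hu => (hdiff u (h0.trans_le hu.1) (hu.2.trans_lt hs)).continuousAt.continuousWithinAt
    · rw [interior_Icc]
      exact fun u hu => (hdiff u (h0.trans hu.1) (hu.2.trans hs)).differentiableWithinAt
    · rw [interior_Icc]; exact hc
  have hmono : ∀ t s : ℝ, 0 < t → t ≤ s → s < ξ' → φ t ≤ φ s := by
    intro t s h0 hts hs
    have := hmv t s 0 h0 hts hs
      (fun τ hτ => (hφ' τ (h0.trans hτ.1) (hlt τ (hτ.2.trans hs))).le)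
    linarith
  set S : Set ℝ := φ '' Set.Ioo 0 ξ' with hS
  have hSbdd : BddBelow S := ⟨0, by
    rintro _ ⟨s, hs, rfl⟩; exact hφ0 s hs.1.le (hlt s hs.2)⟩
  have hSne : S.Nonempty := ⟨_, ξ' / 2, ⟨by linarith, by linarith⟩, rfl⟩
  set c₀ := sInf S
  have hc₀ : ∀ s, 0 < s → s < ξ' → c₀ ≤ φ s := fun s h0 h1 => csInf_le hSbdd ⟨s, ⟨h0, h1⟩, rfl⟩
  refine ⟨r, hr, ξ', hξ'0, fun s => if 0 < s then φ s - c₀ else 0, ?_, ?_, ?_⟩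
  · intro s _ h1
    dsimp only
    split_ifs with h
    · linarith [hc₀ s h h1]
    · exact le_rfl
  · rw [Metric.tendsto_nhdsWithin_nhds]
    intro η hη
    obtain ⟨_, ⟨s₀, hs₀, rfl⟩, hs₀'⟩ := exists_lt_of_csInf_lt hSne (show c₀ < c₀ + η by linarith)
    refine ⟨s₀, hs₀.1, fun {s} hs hd => ?_⟩
    rw [Real.dist_eq, sub_zero] at hd ⊢
    have hs1 : s < s₀ := (abs_lt.1 hd).2
    split_ifs with h
    · rw [abs_lt]
      have h1 := hc₀ s h (hs1.trans hs₀.2)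
      have h2 := hmono s s₀ h hs1.le hs₀.2
      constructor <;> linarith
    · simpa using hη
  · intro t s M ht hts hs hM hz
    have hder : ∀ τ ∈ Set.Ioo t s, M⁻¹ ≤ deriv φ τ := by
      intro τ hτ
      obtain ⟨z, hzr, g, hJ, hg, hgM⟩ := hz τ hτ
      have hτ0 : 0 < τ := ht.trans_lt hτ.1
      have hτξ := hlt τ (hτ.2.trans hs)
      have h1 := hKL z (hrU hzr) (by linarith) (by
        rw [hJ, EReal.coe_add]
        exact EReal.add_lt_add_left_coe hτξ _)
      rw [hJ, add_sub_cancel_left] at h1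
      have h2 : Metric.infEDist 0 (limitingSubdiff J z) ≤ ENNReal.ofReal M := by
        refine (Metric.infEDist_le_edist_of_mem (mem_limitingSubdiff_of_hasFDerivAt hg)).trans ?_
        rw [edist_dist, dist_zero_left]
        exact ENNReal.ofReal_le_ofReal hgM
      have h3 : (1 : ENNReal) ≤ ENNReal.ofReal (deriv φ τ * M) := by
        rw [ENNReal.ofReal_mul (hφ' τ hτ0 hτξ).le]
        exact h1.trans (by gcongr)
      rw [ENNReal.one_le_ofReal] at h3
      rwa [inv_le_iff_one_le_mul₀ hM]
    have key : ∀ t', 0 < t' → t ≤ t' → t' ≤ s → s - t' ≤ M * (φ s - φ t') := by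
      intro t' h0 h1 h2
      have := hmv t' s M⁻¹ h0 h2 hs (fun τ hτ => hder τ ⟨h1.trans_lt hτ.1, hτ.2⟩)
      rwa [inv_mul_le_iff₀ hM] at this
    rcases ht.eq_or_lt with rfl | ht0
    · rcases hts.eq_or_lt with rfl | hs0
      · simp
      · simp only [hs0, if_true, lt_irrefl, if_false, sub_zero]
        -- the levels `t' > 0` shrink to zero
        have : ∀ᶠ t' in 𝓝[>] (0 : ℝ), s - t' ≤ M * (φ s - c₀) := by
          filter_upwards [Ioo_mem_nhdsGT hs0] with t' ht'
          have h1 := key t' ht'.1 ht'.1.le ht'.2.le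
          have h2 := hc₀ t' ht'.1 (ht'.2.trans hs)
          nlinarith
        refine le_of_tendsto (f := fun t' : ℝ => s - t') (x := 𝓝[>] 0) ?_ this
        have : Tendsto (fun t' : ℝ => s - t') (𝓝 0) (𝓝 (s - 0)) := by
          exact (continuous_const.sub continuous_id).tendsto 0
        simpa using this.mono_left nhdsWithin_le_nhds
    · have := key t ht0 le_rfl hts
      simp only [ht0, ht0.trans_le hts, if_true]
      linarith

end KL

/-! ### Trapping and summation -/

/-- If the path length after time `K₀` is at most `B K₀` for as long as the sequence stays near its
cluster point `a`, and `B` tends to zero, then the sequence is trapped near `a`, and converges. -/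
lemma tendsto_of_trapped {X : Type*} [PseudoMetricSpace X] {x : ℕ → X} {a : X}
    (ha : MapClusterPt a atTop x) {r : ℝ} (hr : 0 < r) {B : ℕ → ℝ} (hB : Tendsto B atTop (𝓝 0))
    {K : ℕ} (h : ∀ K₀ ≥ K, ∀ N ≥ K₀, (∀ k ∈ Finset.Ico K₀ N, x k ∈ Metric.ball a r) →
      ∑ k ∈ Finset.Ico K₀ N, dist (x k) (x (k + 1)) ≤ B K₀) :
    Tendsto x atTop (𝓝 a) := by
  rw [Metric.tendsto_atTop]
  intro η hη
  obtain ⟨ζ, hζ, hζη, hζr⟩ : ∃ ζ > 0, ζ ≤ η ∧ ζ ≤ r := ⟨min η r, by positivity, by simp, by simp⟩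
  obtain ⟨K₀, hK₀, hB₀, hK₀'⟩ := ((mapClusterPt_iff_frequently.1 ha _
    (Metric.ball_mem_nhds a (half_pos hζ))).and_eventually
    ((hB.eventually_lt_const (half_pos hζ)).and (eventually_ge_atTop K))).exists
  have key : ∀ N ≥ K₀, x N ∈ Metric.ball a ζ := by
    intro N
    induction N using Nat.strong_induction_on with
    | _ N ih =>
      intro hN
      have h1 := h K₀ hK₀' N hN fun k hk =>
        Metric.ball_subset_ball hζr (ih k (Finset.mem_Ico.1 hk).2 (Finset.mem_Ico.1 hk).1)
      have h2 := dist_le_Ico_sum_dist x hN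
      have h3 := dist_triangle_left (x N) a (x K₀)
      rw [Metric.mem_ball] at hK₀ ⊢
      linarith
  exact ⟨K₀, fun N hN => (Metric.mem_ball.1 (key N hN)).trans_le hζη⟩

lemma sum_window_le {δ : ℕ → ℝ} (hδ : ∀ k, 0 ≤ δ k) (W K N : ℕ) :
    ∑ k ∈ Finset.Ico K N, ∑ j ∈ Finset.Ico (k - W) (k + 1), δ j ≤
      (W + 1) * ∑ j ∈ Finset.Ico (K - W) N, δ j := by
  have h1 : ∑ k ∈ Finset.Ico K N, ∑ j ∈ Finset.Ico (k - W) (k + 1), δ j =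
      ∑ j ∈ Finset.Ico (K - W) N, ∑ k ∈ Finset.Ico K N with k - W ≤ j ∧ j < k + 1, δ j := by
    refine Finset.sum_comm' fun k j => ?_
    simp only [Finset.mem_Ico, Finset.mem_filter]
    omega
  rw [h1, Finset.mul_sum]
  refine Finset.sum_le_sum fun j _ => ?_
  rw [Finset.sum_const, nsmul_eq_mul]
  refine mul_le_mul_of_nonneg_right ?_ (hδ j)
  have : (Finset.Ico K N |>.filter fun k => k - W ≤ j ∧ j < k + 1) ⊆ Finset.Icc j (j + W) := by
    intro k
    simp only [Finset.mem_Ico, Finset.mem_filter, Finset.mem_Icc]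
    omega
  have h2 := Finset.card_le_card this
  rw [Nat.card_Icc] at h2
  have h3 : j + W + 1 - j = W + 1 := by omega
  rw [h3] at h2
  exact_mod_cast h2

/-! ### Bookkeeping of the block updates -/

section LastUpdate

variable {m : ℕ} (b : ℕ → Fin m)

lemma lastUpdate_le (i : Fin m) (k : ℕ) : lastUpdate b i k ≤ k := Nat.findGreatest_le k

lemma lastUpdate_succ (i : Fin m) (k : ℕ) :
    lastUpdate b i (k + 1) = if b (k + 1) = i then k + 1 else lastUpdate b i k := by
  simp [lastUpdate, Nat.findGreatest_succ]

variable {b}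

lemma EssentiallyCyclic.lastUpdate_spec {T : ℕ} (hT : EssentiallyCyclic b T) (i : Fin m) {k : ℕ}
    (hk : T ≤ k) : k < lastUpdate b i k + T ∧ 1 ≤ lastUpdate b i k ∧ b (lastUpdate b i k) = i := by
  obtain ⟨κ, hκ, rfl⟩ := hT.2 i (k - T)
  rw [Finset.mem_Icc] at hκ
  have h1 : κ ≤ lastUpdate b (b κ) k :=
    Nat.le_findGreatest (by omega) ⟨by omega, rfl⟩
  have h2 := Nat.findGreatest_spec (P := fun j => 1 ≤ j ∧ b j = b κ) (m := κ) (n := k) (by omega)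
    ⟨by omega, rfl⟩
  exact ⟨by omega, h2.1, h2.2⟩

variable (b)

/-- The sum over all blocks of the value of `g` at the last update of the block. It telescopes:
an iteration replaces the value at the previous update of the selected block by the current one. -/
noncomputable def lastSum (g : ℕ → ℝ) (k : ℕ) : ℝ := ∑ i, g (lastUpdate b i k)

lemma lastSum_succ (g : ℕ → ℝ) (k : ℕ) :
    lastSum b g (k + 1) = lastSum b g k + g (k + 1) - g (lastUpdate b (b (k + 1)) k) := by
  classical
  unfold lastSum
  rw [← Finset.add_sum_erase _ _ (Finset.mem_univ (b (k + 1))),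
    ← Finset.add_sum_erase _ (fun i => g (lastUpdate b i k)) (Finset.mem_univ (b (k + 1)))]
  have : ∑ i ∈ Finset.univ.erase (b (k + 1)), g (lastUpdate b i (k + 1)) =
      ∑ i ∈ Finset.univ.erase (b (k + 1)), g (lastUpdate b i k) := by
    refine Finset.sum_congr rfl fun i hi => ?_
    rw [lastUpdate_succ, if_neg (Finset.ne_of_mem_erase hi).symm]
  rw [this, lastUpdate_succ, if_pos rfl]
  ring

lemma lastSum_nonneg {g : ℕ → ℝ} (hg : ∀ k, 0 ≤ g k) (k : ℕ) : 0 ≤ lastSum b g k :=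
  Finset.sum_nonneg fun _ _ => hg _

variable {b}

lemma EssentiallyCyclic.tendsto_lastSum {T : ℕ} (hT : EssentiallyCyclic b T) {g : ℕ → ℝ}
    (hg : Tendsto g atTop (𝓝 0)) : Tendsto (lastSum b g) atTop (𝓝 0) := by
  have h : ∀ i, Tendsto (fun k => g (lastUpdate b i k)) atTop (𝓝 0) := fun i => by
    refine hg.comp (tendsto_atTop.2 fun N => ?_)
    filter_upwards [eventually_ge_atTop (N + T)] with k hk
    have := (hT.lastUpdate_spec i (k := k) (by omega)).1
    omega
  have h' := tendsto_finsetSum Finset.univ fun i _ => h i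
  simp only [Finset.sum_const_zero] at h'
  exact h'

end LastUpdate

/-- Summation of the recursive bound on the weighted steps `a`. The multiple of `a` at the previous
update is absorbed by `lastSum`, and the window sums by the smallness of `η`. -/
lemma sum_steps_le {m : ℕ} (b : ℕ → Fin m) {a δ u ζ : ℕ → ℝ} {η c : ℝ} {W K N : ℕ}
    (ha : ∀ k, 0 ≤ a k) (hδ : ∀ k, 0 ≤ δ k) (hδa : ∀ k, 8 * η * (W + 1) * δ k ≤ a (k + 1))
    (hc : 0 ≤ c) (hu : ∀ k ≥ K, 0 ≤ u k) (hη : 0 ≤ η) (hKN : K ≤ N)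
    (h : ∀ k ∈ Finset.Ico K N, a (k + 1) ≤ 1 / 2 * a (lastUpdate b (b (k + 1)) k) +
      η * (∑ j ∈ Finset.Ico (k - W) (k + 1), δ j + ζ k) + c * (u k - u (k + 1))) :
    ∑ k ∈ Finset.Ico K N, a (k + 1) ≤ 4 * (1 / 2 * lastSum b a K +
      η * ((W + 1) * ∑ j ∈ Finset.Ico (K - W) K, δ j + ∑ k ∈ Finset.Ico K N, ζ k) + c * u K) := by
  have h1 : ∑ k ∈ Finset.Ico K N, (1 / 2 * a (k + 1)) ≤ ∑ k ∈ Finset.Ico K N,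
      (1 / 2 * (lastSum b a k - lastSum b a (k + 1)) +
      η * (∑ j ∈ Finset.Ico (k - W) (k + 1), δ j + ζ k) + c * (u k - u (k + 1))) := by
    refine Finset.sum_le_sum fun k hk => ?_
    have := h k hk
    have := lastSum_succ b a k
    linarith
  have htel : ∀ v : ℕ → ℝ, ∑ k ∈ Finset.Ico K N, (v k - v (k + 1)) = v K - v N := by
    intro v
    have := Finset.sum_Ico_sub v hKN
    rw [← neg_inj, ← Finset.sum_neg_distrib]
    simpa using this
  simp only [Finset.sum_add_distrib, ← Finset.mul_sum, htel] at h1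
  have h2 := sum_window_le hδ W K N
  have h3 : ∑ j ∈ Finset.Ico (K - W) N, δ j =
      ∑ j ∈ Finset.Ico (K - W) K, δ j + ∑ j ∈ Finset.Ico K N, δ j :=
    (Finset.sum_Ico_consecutive δ (Nat.sub_le K W) hKN).symm
  have h4 : 8 * η * (W + 1) * ∑ j ∈ Finset.Ico K N, δ j ≤ ∑ k ∈ Finset.Ico K N, a (k + 1) := by
    rw [Finset.mul_sum]
    exact Finset.sum_le_sum fun k _ => hδa k
  rw [h3] at h2
  have h5 := mul_le_mul_of_nonneg_left h2 hη
  have h6 := lastSum_nonneg b ha N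
  have h7 := mul_nonneg hc (hu N hKN)
  have h8 : 0 ≤ ∑ k ∈ Finset.Ico K N, a (k + 1) := Finset.sum_nonneg fun k _ => ha _
  nlinarith

/-- The square root of the descent estimate `a² / 2 ≤ a'² / 16 + C * A * D`. -/
lemma le_of_sq_descent {a a' C A D η : ℝ} (ha' : 0 ≤ a') (hA : 0 ≤ A) (hη : 0 < η)
    (hC : 0 < C) (hD : 0 ≤ D) (h : a ^ 2 / 2 - a' ^ 2 / 16 ≤ C * A * D) :
    a ≤ 1 / 2 * a' + η * A + C / (2 * η) * D := by
  have hE : 0 ≤ C / (2 * η) * D := by positivity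
  refine le_of_sq_le_sq ?_ (by positivity)
  have h1 : 4 * (η * A) * (C / (2 * η) * D) = 2 * (C * A * D) := by field_simp; ring
  nlinarith [sq_nonneg (η * A - C / (2 * η) * D), mul_nonneg ha' (mul_nonneg hη.le hA),
    mul_nonneg ha' hE, sq_nonneg a']

/-! ### Block projections -/

section BlockPart

variable {n m : ℕ} (blk : Fin n → Fin m) (i : Fin m)

lemma blockPart_apply (v : EuclideanSpace ℝ (Fin n)) (j : Fin n) :
    blockPart blk i v j = if blk j = i then v j else 0 := rfl

lemma norm_blockPart_le (v : EuclideanSpace ℝ (Fin n)) : ‖blockPart blk i v‖ ≤ ‖v‖ := by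
  rw [EuclideanSpace.norm_eq, EuclideanSpace.norm_eq]
  refine Real.sqrt_le_sqrt (Finset.sum_le_sum fun j _ => ?_)
  rw [blockPart_apply]
  split_ifs
  · exact le_rfl
  · simpa using sq_nonneg (v j)

lemma blockPart_sub (u v : EuclideanSpace ℝ (Fin n)) :
    blockPart blk i (u - v) = blockPart blk i u - blockPart blk i v := by
  ext j
  simp only [blockPart_apply, PiLp.sub_apply]
  split_ifs <;> simp

lemma blockPart_smul (c : ℝ) (v : EuclideanSpace ℝ (Fin n)) :
    blockPart blk i (c • v) = c • blockPart blk i v := by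
  ext j
  simp only [blockPart_apply, PiLp.smul_apply]
  split_ifs <;> simp

variable {blk i}

lemma blockPart_eq_self {v : EuclideanSpace ℝ (Fin n)} (h : ∀ j, blk j ≠ i → v j = 0) :
    blockPart blk i v = v := by
  ext j
  rw [blockPart_apply]
  split_ifs with hj
  · rfl
  · exact (h j hj).symm

variable (blk i)

lemma inner_blockPart_left (u v : EuclideanSpace ℝ (Fin n)) :
    inner ℝ (blockPart blk i u) v = inner ℝ u (blockPart blk i v) := by
  simp only [PiLp.inner_apply, blockPart_apply]
  refine Finset.sum_congr rfl fun j _ => ?_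
  split_ifs <;> simp

end BlockPart

/-! ### Descent of the objective -/

lemma hasGradientAt_gradient {n : ℕ} {f : EuclideanSpace ℝ (Fin n) → ℝ} (hf : ContDiff ℝ 1 f)
    (x : EuclideanSpace ℝ (Fin n)) : HasGradientAt f (gradient f x) x :=
  (hf.differentiable one_ne_zero x).hasGradientAt

lemma continuous_gradient {n : ℕ} {f : EuclideanSpace ℝ (Fin n) → ℝ}
    (hf : ContDiff ℝ 1 f) : Continuous (gradient f) :=
  (InnerProductSpace.toDual ℝ _).symm.continuous.comp (hf.continuous_fderiv one_ne_zero)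

/-- The descent lemma along one block. -/
lemma IsBlockLipschitzAt.le_add {n m : ℕ} {f : EuclideanSpace ℝ (Fin n) → ℝ}
    {blk : Fin n → Fin m} {i : Fin m} {x : EuclideanSpace ℝ (Fin n)} {c : ℝ}
    (h : IsBlockLipschitzAt f blk i x c) (hf : ContDiff ℝ 1 f) {y : EuclideanSpace ℝ (Fin n)}
    (hy : ∀ j, blk j ≠ i → y j = x j) :
    f y ≤ f x + inner ℝ (gradient f x) (y - x) + c / 2 * ‖y - x‖ ^ 2 := by
  set d := y - x with hd
  have hdb : blockPart blk i d = d := blockPart_eq_self fun j hj => by simp [hd, hy j hj]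
  set g : ℝ → ℝ := fun t => f (x + t • d) - t * inner ℝ (gradient f x) d - c / 2 * ‖d‖ ^ 2 * t ^ 2
  have hg : ∀ t, HasDerivAt g
      (inner ℝ (gradient f (x + t • d) - gradient f x) d - c * ‖d‖ ^ 2 * t) t := by
    intro t
    have h1 : HasDerivAt (fun t : ℝ => x + t • d) d t := by
      simpa using ((hasDerivAt_id t).smul_const d).const_add x
    have h2 := (hasGradientAt_gradient hf (x + t • d)).hasFDerivAt.comp_hasDerivAt t h1
    have h3 := (h2.sub ((hasDerivAt_id t).mul_const (inner ℝ (gradient f x) d))).sub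
      ((hasDerivAt_pow 2 t).const_mul (c / 2 * ‖d‖ ^ 2))
    refine h3.congr_deriv ?_
    rw [inner_sub_left]
    simp only [InnerProductSpace.toDual_apply_apply]
    norm_num
    ring
  have hanti : AntitoneOn g (Set.Icc 0 1) := by
    refine antitoneOn_of_deriv_nonpos (convex_Icc 0 1)
      (fun t _ => (hg t).continuousAt.continuousWithinAt)
      (fun t _ => (hg t).differentiableAt.differentiableWithinAt) fun t ht => ?_
    rw [interior_Icc] at ht
    rw [(hg t).deriv]
    have h1 := h (x + t • d) x (fun j hj => by simp [hd, hy j hj]) (fun j _ => rfl)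
    rw [add_sub_cancel_left, blockPart_smul, hdb, norm_smul, Real.norm_of_nonneg ht.1.le] at h1
    have h2 := real_inner_le_norm (blockPart blk i (gradient f (x + t • d) - gradient f x)) d
    rw [inner_blockPart_left, hdb] at h2
    nlinarith [mul_le_mul_of_nonneg_right h1 (norm_nonneg d)]
  have := hanti (Set.left_mem_Icc.2 zero_le_one) (Set.right_mem_Icc.2 zero_le_one) zero_le_one
  simp only [g, zero_smul, one_smul, add_zero, hd, add_sub_cancel] at this ⊢
  linarith

/-- The tangent line inequality for the concave function `s ↦ s ^ p`. -/
lemma rpow_le_tangent {p s t : ℝ} (hp0 : 0 < p) (hp1 : p < 1) (hs : 0 < s) (ht : 0 ≤ t) :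
    t ^ p ≤ s ^ p + p * s ^ (p - 1) * (t - s) := by
  have h := rpow_one_add_le_one_add_mul_self (s := t / s - 1)
    (by have : 0 ≤ t / s := by positivity
        linarith) hp0.le hp1.le
  rw [add_sub_cancel, Real.div_rpow ht hs.le] at h
  have hsp : 0 < s ^ p := by positivity
  rw [div_le_iff₀ hsp] at h
  rw [Real.rpow_sub_one hs.ne']
  refine h.trans (le_of_eq ?_)
  field_simp

/-- A minimizer of the subproblem has the quadratic growth given by strong convexity. -/
lemma subproblem_growth {n m : ℕ} {f : EuclideanSpace ℝ (Fin n) → ℝ} {blk : Fin n → Fin m}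
    {i : Fin m} {y v : EuclideanSpace ℝ (Fin n)} {c : ℝ} {w : Fin n → ℝ}
    (hw : ∀ j, 0 ≤ w j)
    (hv : ∀ u, subproblem f blk i y (1 / (2 * c)) w v ≤ subproblem f blk i y (1 / (2 * c)) w u)
    (u : EuclideanSpace ℝ (Fin n)) :
    subproblem f blk i y (1 / (2 * c)) w v + c * ‖blockPart blk i (u - v)‖ ^ 2 ≤
      subproblem f blk i y (1 / (2 * c)) w u := by
  have hc : 1 / (2 * (1 / (2 * c))) = c := by
    rcases eq_or_ne c 0 with rfl | hc
    · simp
    · field_simp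
  have key : ∀ t ∈ Set.Ioo (0 : ℝ) 1, 0 ≤ subproblem f blk i y (1 / (2 * c)) w u -
      subproblem f blk i y (1 / (2 * c)) w v - (1 - t) * (c * ‖blockPart blk i (u - v)‖ ^ 2) := by
    intro t ht
    have h1 := hv (v + t • (u - v))
    have h2 : ∑ j with blk j = i, w j * |(v + t • (u - v)) j| ≤
        (1 - t) * ∑ j with blk j = i, w j * |v j| + t * ∑ j with blk j = i, w j * |u j| := by
      rw [Finset.mul_sum, Finset.mul_sum, ← Finset.sum_add_distrib]
      refine Finset.sum_le_sum fun j _ => ?_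
      have h3 : |(v + t • (u - v)) j| ≤ (1 - t) * |v j| + t * |u j| := by
        have : (v + t • (u - v)) j = (1 - t) * v j + t * u j := by simp; ring
        rw [this]
        refine (abs_add_le _ _).trans (le_of_eq ?_)
        rw [abs_mul, abs_mul, abs_of_pos ht.1, abs_of_pos (by linarith [ht.2] : 0 < 1 - t)]
      nlinarith [mul_le_mul_of_nonneg_left h3 (hw j)]
    have h4 : ‖blockPart blk i (v + t • (u - v) - y)‖ ^ 2 =
        (1 - t) * ‖blockPart blk i (v - y)‖ ^ 2 + t * ‖blockPart blk i (u - y)‖ ^ 2 -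
          t * (1 - t) * ‖blockPart blk i (u - v)‖ ^ 2 := by
      have e1 : blockPart blk i (v + t • (u - v) - y) =
          blockPart blk i (v - y) + t • blockPart blk i (u - v) := by
        rw [← blockPart_smul]
        ext j; simp only [blockPart_apply, PiLp.add_apply, PiLp.sub_apply]
        split_ifs <;> simp; ring
      have e2 : blockPart blk i (u - y) = blockPart blk i (v - y) + blockPart blk i (u - v) := by
        simp only [blockPart_sub]; abel
      rw [e1, e2, norm_add_sq_real, norm_add_sq_real, inner_smul_right, norm_smul, mul_pow,
        Real.norm_eq_abs, sq_abs]
      ring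
    have h5 : inner ℝ (blockPart blk i (gradient f y)) (v + t • (u - v)) =
        (1 - t) * inner ℝ (blockPart blk i (gradient f y)) v +
          t * inner ℝ (blockPart blk i (gradient f y)) u := by
      rw [inner_add_right, inner_smul_right, inner_sub_right]; ring
    unfold subproblem at h1 ⊢
    rw [hc] at h1 ⊢
    rw [h4, h5] at h1
    have ht0 := ht.1
    refine nonneg_of_mul_nonneg_right (a := t) ?_ ht.1
    linarith
  have hlim : Tendsto (fun t : ℝ => subproblem f blk i y (1 / (2 * c)) w u -
      subproblem f blk i y (1 / (2 * c)) w v - (1 - t) * (c * ‖blockPart blk i (u - v)‖ ^ 2))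
      (𝓝[>] 0) (𝓝 (subproblem f blk i y (1 / (2 * c)) w u -
      subproblem f blk i y (1 / (2 * c)) w v - (1 - 0) * (c * ‖blockPart blk i (u - v)‖ ^ 2))) := by
    refine Tendsto.mono_left (Continuous.tendsto ?_ 0) nhdsWithin_le_nhds
    fun_prop
  have := ge_of_tendsto hlim (by
    filter_upwards [Ioo_mem_nhdsGT one_pos] with t ht using key t ht)
  linarith

section Algorithm

variable {n m : ℕ} {f : EuclideanSpace ℝ (Fin n) → ℝ} {blk : Fin n → Fin m}
    {lam p ℓ L δ μ : ℝ} {b : ℕ → Fin m} {β Lk : ℕ → ℝ} {x : ℕ → EuclideanSpace ℝ (Fin n)}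
    {ε : ℕ → Fin n → ℝ}

/-- The step `x^k - x^{k-1}` measured with the weight `√(L_k)`. It vanishes for `k = 0`, in
agreement with the initialization `x^{-1} = x^0`. -/
noncomputable def scaledStep (Lk : ℕ → ℝ) (x : ℕ → EuclideanSpace ℝ (Fin n)) (k : ℕ) : ℝ :=
  √(Lk k) * ‖x k - x (k - 1)‖

lemma scaledStep_nonneg (k : ℕ) : 0 ≤ scaledStep Lk x k := by unfold scaledStep; positivity

lemma scaledStep_zero : scaledStep Lk x 0 = 0 := by simp [scaledStep]

lemma scaledStep_succ (k : ℕ) : scaledStep Lk x (k + 1) = √(Lk (k + 1)) * ‖x (k + 1) - x k‖ := rfl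

lemma IsBPIREeLp.Lk_pos (h : IsBPIREeLp f blk lam p ℓ L δ μ b β Lk x ε) (hℓ : 0 < ℓ) (k : ℕ) :
    0 < Lk (k + 1) := hℓ.trans_le (h.lip_const k).1

lemma IsBPIREeLp.apply_lastUpdate (h : IsBPIREeLp f blk lam p ℓ L δ μ b β Lk x ε) (k : ℕ)
    (j : Fin n) : x (lastUpdate b (blk j) k) j = x k j := by
  induction k with
  | zero => rw [Nat.le_zero.1 (lastUpdate_le b (blk j) 0)]
  | succ k ih =>
    rw [lastUpdate_succ]
    split_ifs with hb
    · rfl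
    · rw [ih, h.unselected k j (Ne.symm hb)]

lemma IsBPIREeLp.norm_extrapolated_sub_le (h : IsBPIREeLp f blk lam p ℓ L δ μ b β Lk x ε) (k : ℕ) :
    ‖extrapolated blk b β x k - x k‖ ≤ β (k + 1) *
      ‖x (lastUpdate b (b (k + 1)) k) - x (lastUpdate b (b (k + 1)) k - 1)‖ := by
  have h1 : blockPart blk (b (k + 1)) (x k) =
      blockPart blk (b (k + 1)) (x (lastUpdate b (b (k + 1)) k)) := by
    ext j
    simp only [blockPart_apply]
    split_ifs with hj
    · rw [← hj, h.apply_lastUpdate]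
    · rfl
  rw [extrapolated, add_sub_cancel_left, norm_smul, Real.norm_of_nonneg (h.beta_mem k).1,
    blockPart_sub, h1, ← blockPart_sub]
  exact mul_le_mul_of_nonneg_left (norm_blockPart_le _ _ _) (h.beta_mem k).1

lemma extrapolated_apply_of_ne {k : ℕ} {j : Fin n} (hj : blk j ≠ b (k + 1)) :
    extrapolated blk b β x k j = x k j := by
  simp [extrapolated, blockPart_apply, hj]

lemma IsBPIREeLp.sq_extrapolated_le (h : IsBPIREeLp f blk lam p ℓ L δ μ b β Lk x ε)
    (hℓ : 0 < ℓ) (hδ : δ < 1) (k : ℕ) :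
    Lk (k + 1) * ‖extrapolated blk b β x k - x k‖ ^ 2 ≤
      scaledStep Lk x (lastUpdate b (b (k + 1)) k) ^ 2 / 36 := by
  have h1 := h.norm_extrapolated_sub_le k
  have h2 := h.beta_le k
  have hβ := (h.beta_mem k).1
  have hL := h.Lk_pos hℓ k
  set κ := lastUpdate b (b (k + 1)) k
  rcases Nat.eq_zero_or_pos κ with h0 | h0
  · rw [h0] at h1 ⊢
    simp only [Nat.zero_sub, sub_self, norm_zero, mul_zero] at h1
    rw [le_antisymm h1 (norm_nonneg _), scaledStep_zero]
    simp
  · have hLκ : 0 < Lk κ := by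
      obtain ⟨κ', hκ'⟩ := Nat.exists_eq_succ_of_ne_zero h0.ne'
      rw [hκ']; exact h.Lk_pos hℓ κ'
    have h3 : β (k + 1) ≤ 1 / 6 * √(Lk κ / Lk (k + 1)) :=
      (h2 h0).trans (by gcongr)
    have h4 : β (k + 1) ^ 2 ≤ 1 / 36 * (Lk κ / Lk (k + 1)) := by
      calc β (k + 1) ^ 2 ≤ (1 / 6 * √(Lk κ / Lk (k + 1))) ^ 2 := by gcongr
        _ = _ := by rw [mul_pow, Real.sq_sqrt (by positivity)]; norm_num
    calc Lk (k + 1) * ‖extrapolated blk b β x k - x k‖ ^ 2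
        ≤ Lk (k + 1) * (β (k + 1) * ‖x κ - x (κ - 1)‖) ^ 2 := by gcongr
      _ = Lk (k + 1) * β (k + 1) ^ 2 * ‖x κ - x (κ - 1)‖ ^ 2 := by ring
      _ ≤ Lk (k + 1) * (1 / 36 * (Lk κ / Lk (k + 1))) * ‖x κ - x (κ - 1)‖ ^ 2 := by gcongr
      _ = _ := by
        unfold scaledStep
        rw [mul_pow, Real.sq_sqrt hLκ.le]
        field_simp

lemma IsBPIREeLp.eps_le (h : IsBPIREeLp f blk lam p ℓ L δ μ b β Lk x ε) (hμ : μ < 1) (k : ℕ)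
    (i : Fin n) : ε (k + 1) i ≤ ε k i := by
  by_cases hx : x (k + 1) i = 0
  · exact (h.eps_of_eq_zero k i hx).le
  · refine (h.eps_of_ne_zero k i hx).trans (mul_le_of_le_one_left (h.eps_pos k i).le ?_)
    exact Real.sqrt_le_one.2 hμ.le

lemma weight_nonneg (hlam : 0 < lam) (hp : 0 < p) (u : EuclideanSpace ℝ (Fin n)) (e : Fin n → ℝ)
    (j : Fin n) : 0 ≤ weight lam p u e j := by
  unfold weight; positivity

/-- The change of the objective in one iteration, the extrapolation being paid for by the last step
of the same block. -/
lemma IsBPIREeLp.descent (h : IsBPIREeLp f blk lam p ℓ L δ μ b β Lk x ε)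
    (hf : ContDiff ℝ 1 f) (hlam : 0 < lam) (hp : 0 < p ∧ p < 1) (hδ : δ < 1) (hμ : μ < 1)
    (hℓ : 0 < ℓ) (k : ℕ) :
    scaledStep Lk x (k + 1) ^ 2 / 2 - scaledStep Lk x (lastUpdate b (b (k + 1)) k) ^ 2 / 16 ≤
      objective f lam p (x k) (ε k) - objective f lam p (x (k + 1)) (ε (k + 1)) := by
  have hL := h.Lk_pos hℓ k
  have hE := h.sq_extrapolated_le hℓ hδ k
  rw [scaledStep_succ, mul_pow, Real.sq_sqrt hL.le]
  set c := Lk (k + 1) with hc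
  set i := b (k + 1) with hi
  set y := extrapolated blk b β x k with hy
  set d := x (k + 1) - x k with hd
  have hdb : blockPart blk i d = d := blockPart_eq_self fun j hj => by
    simp [hd, h.unselected k j hj]
  have heb : blockPart blk i (y - x k) = y - x k := blockPart_eq_self fun j hj => by
    rw [PiLp.sub_apply, hy, extrapolated_apply_of_ne hj, sub_self]
  -- the smooth part
  have h1 := (h.lip_const k).2.2.le_add hf (h.unselected k)
  have h2 : inner ℝ (gradient f (x k)) d ≤ inner ℝ (gradient f y) d + c * ‖y - x k‖ * ‖d‖ := by
    have h3 := (h.lip_const k).2.2 (x k) y (fun _ _ => rfl)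
      (fun j hj => extrapolated_apply_of_ne hj)
    rw [← neg_sub y (x k), ← neg_one_smul ℝ (y - x k), blockPart_smul, heb, neg_one_smul,
      norm_neg] at h3
    have h4 := real_inner_le_norm (blockPart blk i (gradient f (x k) - gradient f y)) d
    rw [inner_blockPart_left, hdb, inner_sub_left] at h4
    nlinarith [mul_le_mul_of_nonneg_right h3 (norm_nonneg d)]
  -- the penalty
  have h5 : lam * ∑ j, (|x (k + 1) j| + ε (k + 1) j ^ 2) ^ p ≤
      lam * ∑ j, (|x k j| + ε k j ^ 2) ^ p +
        (∑ j with blk j = i, weight lam p (x k) (ε k) j * |x (k + 1) j| -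
          ∑ j with blk j = i, weight lam p (x k) (ε k) j * |x k j|) := by
    rw [Finset.mul_sum, Finset.mul_sum, ← Finset.sum_sub_distrib, Finset.sum_filter,
      ← Finset.sum_add_distrib]
    refine Finset.sum_le_sum fun j _ => ?_
    have e0 := h.eps_pos (k + 1) j
    have e1 := h.eps_pos k j
    have h6 : (|x (k + 1) j| + ε (k + 1) j ^ 2) ^ p ≤ (|x (k + 1) j| + ε k j ^ 2) ^ p := by
      have := h.eps_le hμ k j
      gcongr
      exact hp.1.le
    have h7 := rpow_le_tangent hp.1 hp.2 (s := |x k j| + ε k j ^ 2)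
      (t := |x (k + 1) j| + ε k j ^ 2) (by positivity) (by positivity)
    split_ifs with hj
    · have h8 := mul_le_mul_of_nonneg_left (h6.trans h7) hlam.le
      refine h8.trans (le_of_eq ?_)
      unfold weight
      ring
    · rw [h.unselected k j hj] at h6 ⊢
      nlinarith
  -- the subproblem
  have h9 := subproblem_growth (fun j => weight_nonneg hlam hp.1 _ _ j) (h.selected k) (x k)
  have hcc : 1 / (2 * (1 / (2 * c))) = c := by field_simp
  unfold subproblem at h9
  rw [hcc] at h9
  have e1 : blockPart blk i (x (k + 1) - y) = d - (y - x k) := by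
    rw [← heb]; nth_rw 1 [← hdb]
    rw [← blockPart_sub]; congr 1; rw [hd]; abel
  have e2 : blockPart blk i (x k - y) = -(y - x k) := by
    rw [← heb, ← neg_one_smul ℝ, ← blockPart_smul, neg_one_smul, neg_sub]
  have e3 : blockPart blk i (x k - x (k + 1)) = -d := by
    rw [← hdb, ← neg_one_smul ℝ, ← blockPart_smul, neg_one_smul, hd, neg_sub]
  rw [e1, e2, e3, norm_neg, norm_neg, norm_sub_sq_real] at h9
  have e4 : inner ℝ (blockPart blk i (gradient f y)) (x (k + 1)) =
      inner ℝ (blockPart blk i (gradient f y)) (x k) + inner ℝ (gradient f y) d := by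
    have e5 : inner ℝ (blockPart blk i (gradient f y)) d = inner ℝ (gradient f y) d := by
      rw [inner_blockPart_left, hdb]
    rw [← e5, ← inner_add_right, hd, add_sub_cancel]
  rw [e4] at h9
  have h10 := real_inner_le_norm d (y - x k)
  have h11 : c * inner ℝ d (y - x k) ≤ c * (‖d‖ * ‖y - x k‖) := by gcongr
  have h12 : 0 ≤ c * (‖d‖ - 3 / 2 * ‖y - x k‖) ^ 2 := by positivity
  unfold objective
  nlinarith

end Algorithm

section Algorithm

variable {n m : ℕ} {f : EuclideanSpace ℝ (Fin n) → ℝ} {blk : Fin n → Fin m}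
    {lam p ℓ L δ μ : ℝ} {b : ℕ → Fin m} {β Lk : ℕ → ℝ} {x : ℕ → EuclideanSpace ℝ (Fin n)}
    {ε : ℕ → Fin n → ℝ}

/-! ### Boundedness of the iterates and vanishing of the steps -/

lemma objective_zero_le (hlam : 0 < lam) (hp : 0 < p) (u : EuclideanSpace ℝ (Fin n))
    (e : Fin n → ℝ) : objective f lam p u 0 ≤ objective f lam p u e := by
  unfold objective
  gcongr f u + lam * ∑ j, (|u j| + ?_) ^ p with j
  simpa using sq_nonneg (e j)

lemma le_objective (hlam : 0 < lam) (u : EuclideanSpace ℝ (Fin n)) (e : Fin n → ℝ) :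
    f u ≤ objective f lam p u e := by
  unfold objective
  have : 0 ≤ ∑ j, (|u j| + e j ^ 2) ^ p := Finset.sum_nonneg fun j _ => by positivity
  nlinarith

lemma ProblemAssumption.exists_norm_le (hF : ProblemAssumption f blk lam p ℓ L) (hlam : 0 < lam)
    (hp : 0 < p) (hdesc : Antitone fun k => objective f lam p (x k) (ε k)) :
    ∃ R > 0, ∀ k, ‖x k‖ ≤ R := by
  have h := hF.coercive.eventually_gt_atTop (objective f lam p (x 0) (ε 0))
  have hb : Bornology.IsBounded
      {u | objective f lam p (x 0) (ε 0) < objective f lam p u 0}ᶜ := by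
    rw [Bornology.isBounded_def, compl_compl]; exact h
  obtain ⟨R, hR, hR'⟩ := hb.exists_pos_norm_le
  refine ⟨R, hR, fun k => hR' _ ?_⟩
  simp only [Set.mem_compl_iff, Set.mem_ofPred_eq, not_lt]
  exact (objective_zero_le hlam hp _ _).trans (hdesc (Nat.zero_le k))

lemma ProblemAssumption.bddBelow_objective (hF : ProblemAssumption f blk lam p ℓ L)
    (hlam : 0 < lam) (hp : 0 < p) (hdesc : Antitone fun k => objective f lam p (x k) (ε k)) :
    ∃ c, ∀ k, c ≤ objective f lam p (x k) (ε k) := by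
  obtain ⟨R, -, hR⟩ := hF.exists_norm_le hlam hp hdesc
  obtain ⟨C, hC⟩ := (isCompact_closedBall (0 : EuclideanSpace ℝ (Fin n)) R).exists_bound_of_continuousOn
    hF.contDiff.continuous.continuousOn
  refine ⟨-C, fun k => le_trans ?_ (le_objective hlam _ _)⟩
  exact (abs_le.1 (hC (x k) (by simpa using hR k))).1

lemma tendsto_of_antitone_of_le {g : ℕ → ℝ} (hg : Antitone g) {c : ℝ} (hc : ∀ k, c ≤ g k) :
    ∃ l, Tendsto g atTop (𝓝 l) :=
  ⟨_, tendsto_atTop_ciInf hg ⟨c, by rintro _ ⟨k, rfl⟩; exact hc k⟩⟩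

/-- The scaled steps are square summable, since the objective with `1 / 16` of the squared last
steps of all blocks added decreases by `7 / 16` of the new squared step; hence they vanish. -/
lemma IsBPIREeLp.tendsto_scaledStep (h : IsBPIREeLp f blk lam p ℓ L δ μ b β Lk x ε)
    (hF : ProblemAssumption f blk lam p ℓ L) (hlam : 0 < lam) (hp : 0 < p ∧ p < 1) (hδ : δ < 1)
    (hμ : μ < 1) (hdesc : Antitone fun k => objective f lam p (x k) (ε k)) :
    Tendsto (scaledStep Lk x) atTop (𝓝 0) := by
  obtain ⟨c, hc⟩ := hF.bddBelow_objective hlam hp.1 hdesc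
  set P := lastSum b fun k => scaledStep Lk x k ^ 2
  set V : ℕ → ℝ := fun k => objective f lam p (x k) (ε k) + P k / 16 with hV
  have hstep : ∀ k, 7 / 16 * scaledStep Lk x (k + 1) ^ 2 ≤ V k - V (k + 1) := by
    intro k
    have h1 := h.descent hF.contDiff hlam hp hδ hμ hF.pos k
    have h2 := lastSum_succ b (fun k => scaledStep Lk x k ^ 2) k
    simp only [hV, P]
    linarith
  have hP : ∀ k, 0 ≤ P k := lastSum_nonneg b fun k => sq_nonneg _
  obtain ⟨l, hl⟩ := tendsto_of_antitone_of_le (g := V) (c := c)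
    (antitone_nat_of_succ_le fun k => by nlinarith [hstep k, sq_nonneg (scaledStep Lk x (k + 1))])
    (fun k => by simp only [hV]; linarith [hc k, hP k])
  have h0 : Tendsto (fun k => V k - V (k + 1)) atTop (𝓝 0) := by
    simpa using hl.sub (hl.comp (tendsto_add_atTop_nat 1))
  have h1 : Tendsto (fun k => scaledStep Lk x (k + 1) ^ 2) atTop (𝓝 0) := by
    refine squeeze_zero (g := fun k => 16 / 7 * (V k - V (k + 1))) (fun k => sq_nonneg _)
      (fun k => by linarith [hstep k]) ?_
    simpa using h0.const_mul (16 / 7)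
  have h2 : Tendsto (fun k => scaledStep Lk x (k + 1)) atTop (𝓝 0) := by
    have := h1.sqrt
    simpa [Real.sqrt_sq (scaledStep_nonneg _)] using this
  exact (tendsto_add_atTop_iff_nat 1).1 h2

lemma IsBPIREeLp.sqrt_mul_dist_le (h : IsBPIREeLp f blk lam p ℓ L δ μ b β Lk x ε) (k : ℕ) :
    √ℓ * dist (x k) (x (k + 1)) ≤ scaledStep Lk x (k + 1) := by
  rw [scaledStep_succ, dist_eq_norm, norm_sub_rev]
  have := (h.lip_const k).1
  gcongr

lemma IsBPIREeLp.tendsto_dist (h : IsBPIREeLp f blk lam p ℓ L δ μ b β Lk x ε) (hℓ : 0 < ℓ)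
    (ha : Tendsto (scaledStep Lk x) atTop (𝓝 0)) :
    Tendsto (fun k => dist (x k) (x (k + 1))) atTop (𝓝 0) := by
  have h1 : 0 < √ℓ := Real.sqrt_pos.2 hℓ
  refine squeeze_zero (fun k => dist_nonneg)
    (fun k => (le_div_iff₀' h1).2 (h.sqrt_mul_dist_le k)) ?_
  simpa using (ha.comp (tendsto_add_atTop_nat 1)).div_const √ℓ

/-! ### Stationarity and stabilization of the support -/

/-- The first-order optimality condition of the subproblem at a nonzero coordinate. -/
lemma subproblem_stationary {i : Fin m} {y v : EuclideanSpace ℝ (Fin n)} {c : ℝ} {w : Fin n → ℝ}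
    (hv : ∀ u, subproblem f blk i y (1 / (2 * c)) w v ≤ subproblem f blk i y (1 / (2 * c)) w u)
    {j : Fin n} (hj : blk j = i) (hvj : v j ≠ 0) :
    gradient f y j + 2 * c * (v j - y j) + w j * (SignType.sign (v j) : ℝ) = 0 := by
  classical
  have hc : 1 / (2 * (1 / (2 * c))) = c := by
    rcases eq_or_ne c 0 with rfl | hc
    · simp
    · field_simp
  set e : EuclideanSpace ℝ (Fin n) := EuclideanSpace.single j 1
  have he : blockPart blk i e = e := blockPart_eq_self fun l hl => by
    have : l ≠ j := fun h => hl (h ▸ hj)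
    simp [e, this]
  have hin : ∀ u : EuclideanSpace ℝ (Fin n), inner ℝ u e = u j := fun u => by
    simpa using EuclideanSpace.inner_single_right j (1 : ℝ) u
  have h1 : HasDerivAt (fun t : ℝ => inner ℝ (blockPart blk i (gradient f y)) (v + t • e))
      (gradient f y j) 0 := by
    have : HasDerivAt (fun t : ℝ => inner ℝ (blockPart blk i (gradient f y)) v +
        t * inner ℝ (blockPart blk i (gradient f y)) e)
        (inner ℝ (blockPart blk i (gradient f y)) e) 0 := by
      simpa using ((hasDerivAt_id (0 : ℝ)).mul_const
        (inner ℝ (blockPart blk i (gradient f y)) e)).const_add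
        (inner ℝ (blockPart blk i (gradient f y)) v)
    simp only [inner_add_right, inner_smul_right]
    refine this.congr_deriv ?_
    rw [inner_blockPart_left, he, hin]
  have h2 : HasDerivAt (fun t : ℝ => c * ‖blockPart blk i (v + t • e - y)‖ ^ 2)
      (2 * c * (v j - y j)) 0 := by
    have h3 : ∀ t : ℝ, c * ‖blockPart blk i (v + t • e - y)‖ ^ 2 =
        c * ‖blockPart blk i (v - y)‖ ^ 2 + t * (2 * c * (v j - y j)) + c * t ^ 2 := by
      intro t
      have h4 : blockPart blk i (v + t • e - y) = blockPart blk i (v - y) + t • e := by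
        have h5 : v + t • e - y = (v - y) - (-t) • e := by rw [neg_smul]; abel
        rw [h5, blockPart_sub, blockPart_smul, he, neg_smul, sub_neg_eq_add]
      have h6 : inner ℝ (blockPart blk i (v - y)) e = v j - y j := by
        rw [inner_blockPart_left, he, hin, PiLp.sub_apply]
      rw [h4, norm_add_sq_real, inner_smul_right, h6, norm_smul]
      simp [e]
      ring
    simp only [h3]
    have h7 := (((hasDerivAt_id (0 : ℝ)).mul_const (2 * c * (v j - y j))).const_add
      (c * ‖blockPart blk i (v - y)‖ ^ 2)).add ((hasDerivAt_pow 2 (0 : ℝ)).const_mul c)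
    refine h7.congr_deriv ?_
    simp
  have h3 : HasDerivAt (fun t : ℝ => ∑ l with blk l = i, w l * |(v + t • e) l|)
      (w j * (SignType.sign (v j) : ℝ)) 0 := by
    have h4 : ∀ l ∈ Finset.univ.filter (fun l => blk l = i),
        HasDerivAt (fun t : ℝ => w l * |(v + t • e) l|)
          (if l = j then w j * (SignType.sign (v j) : ℝ) else 0) 0 := by
      intro l _
      split_ifs with hl
      · subst hl
        have h5 : HasDerivAt (fun t : ℝ => v l + t) 1 0 := (hasDerivAt_id (0 : ℝ)).const_add _
        have h6 := (HasDerivAt.comp (0 : ℝ) (h₂ := fun s : ℝ => |s|)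
          (by simpa using hasDerivAt_abs hvj) h5).const_mul (w l)
        simpa [e] using h6
      · simpa [e, hl] using hasDerivAt_const (0 : ℝ) (w l * |v l|)
    refine (HasDerivAt.fun_sum h4).congr_deriv ?_
    rw [Finset.sum_ite_eq', if_pos (by simp [hj])]
  have h4 := (h1.add h2).add h3
  refine IsLocalMin.hasDerivAt_eq_zero (Filter.Eventually.of_forall fun t => ?_) h4
  have := hv (v + t • e)
  unfold subproblem at this
  rw [hc] at this
  simpa using this

/-- A coordinate which is nonzero after an update was not small before it: the weight, which is
unbounded at small arguments, is balanced by a bounded gradient. -/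
lemma IsBPIREeLp.exists_lower_bound (h : IsBPIREeLp f blk lam p ℓ L δ μ b β Lk x ε)
    (hf : ContDiff ℝ 1 f) (hℓ : 0 < ℓ) (hlam : 0 < lam) (hp : 0 < p ∧ p < 1)
    {R : ℝ} (hR : 0 < R) (hx : ∀ k, ‖x k‖ ≤ R) :
    ∃ c > 0, ∀ k j, blk j = b (k + 1) → x (k + 1) j ≠ 0 → c ≤ |x k j| + ε k j ^ 2 := by
  obtain ⟨G, hG⟩ := (isCompact_closedBall (0 : EuclideanSpace ℝ (Fin n))
    (3 * R)).exists_bound_of_continuousOn (continuous_gradient hf).continuousOn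
  have hG0 : 0 ≤ G := (norm_nonneg _).trans (hG 0 (by simp; positivity))
  have hL : 0 < L := hℓ.trans_le ((h.lip_const 0).1.trans (h.lip_const 0).2.1)
  set B := (G + 2 * L * (4 * R)) / (lam * p) with hB
  have hp0 := hp.1
  have hB0 : 0 < B := by positivity
  refine ⟨B ^ (1 / (p - 1)), by positivity, fun k j hj hxj => ?_⟩
  have hs : 0 < |x k j| + ε k j ^ 2 := by have := h.eps_pos k j; positivity
  by_contra! hlt
  have h1 := Real.rpow_lt_rpow_of_neg hs hlt (by linarith [hp.2] : p - 1 < 0)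
  rw [← Real.rpow_mul hB0.le, one_div_mul_cancel (by linarith [hp.2]), Real.rpow_one, hB,
    div_lt_iff₀ (by positivity)] at h1
  have hst := subproblem_stationary (h.selected k) hj hxj
  set y := extrapolated blk b β x k
  have hy : ‖y‖ ≤ 3 * R := by
    have e1 := h.norm_extrapolated_sub_le k
    have e2 : β (k + 1) * ‖x (lastUpdate b (b (k + 1)) k) - x (lastUpdate b (b (k + 1)) k - 1)‖ ≤
        1 * (R + R) := by
      refine mul_le_mul (h.beta_mem k).2 ?_ (norm_nonneg _) zero_le_one
      exact (norm_sub_le _ _).trans (add_le_add (hx _) (hx _))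
    have e3 := norm_le_norm_add_norm_sub' y (x k)
    linarith [hx k]
  have hg : |gradient f y j| ≤ G := (PiLp.norm_apply_le (gradient f y) j).trans
    (hG y (by simpa using hy))
  have hd : |x (k + 1) j - y j| ≤ 4 * R := by
    have e1 := PiLp.norm_apply_le (x (k + 1) - y) j
    have e2 := norm_sub_le (x (k + 1)) y
    rw [PiLp.sub_apply, Real.norm_eq_abs] at e1
    linarith [hx (k + 1)]
  have hw : |weight lam p (x k) (ε k) j * (SignType.sign (x (k + 1) j) : ℝ)| =
      lam * p * (|x k j| + ε k j ^ 2) ^ (p - 1) := by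
    rw [abs_mul, abs_of_nonneg (weight_nonneg hlam hp.1 _ _ _)]
    have : |(SignType.sign (x (k + 1) j) : ℝ)| = 1 := by
      rcases hxj.lt_or_gt with h0 | h0 <;> simp [h0]
    rw [this, weight]; ring
  have h2 : weight lam p (x k) (ε k) j * (SignType.sign (x (k + 1) j) : ℝ) =
      -(gradient f y j + 2 * Lk (k + 1) * (x (k + 1) j - y j)) := by linarith
  rw [h2, abs_neg] at hw
  have h3 : |gradient f y j + 2 * Lk (k + 1) * (x (k + 1) j - y j)| ≤ G + 2 * L * (4 * R) := by
    refine (abs_add_le _ _).trans (add_le_add hg ?_)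
    have e1 := h.Lk_pos hℓ k
    have e2 := (h.lip_const k).2.1
    rw [abs_mul, abs_of_pos (by positivity)]
    gcongr
  linarith

lemma IsBPIREeLp.tendsto_eps (h : IsBPIREeLp f blk lam p ℓ L δ μ b β Lk x ε) (hμ : μ < 1)
    {j : Fin n} (hj : ∃ᶠ k in atTop, x k j ≠ 0) : Tendsto (fun k => ε k j) atTop (𝓝 0) := by
  obtain ⟨l, hl⟩ := tendsto_of_antitone_of_le (g := fun k => ε k j) (c := 0)
    (antitone_nat_of_succ_le fun k => h.eps_le hμ k j) (fun k => (h.eps_pos k j).le)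
  have hl0 : 0 ≤ l := ge_of_tendsto' hl fun k => (h.eps_pos k j).le
  have h1 : ∃ᶠ k in atTop, ε (k + 1) j ≤ √μ * ε k j := by
    rw [frequently_atTop] at hj ⊢
    intro N
    obtain ⟨k, hk, hxk⟩ := hj (N + 1)
    obtain ⟨k, rfl⟩ := Nat.exists_eq_succ_of_ne_zero (show k ≠ 0 by omega)
    exact ⟨k, by omega, h.eps_of_ne_zero k j hxk⟩
  have h2 : l ≤ √μ * l :=
    le_of_tendsto_of_tendsto_of_frequently (hl.comp (tendsto_add_atTop_nat 1))
      (hl.const_mul √μ) h1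
  have h3 : √μ < 1 := (Real.sqrt_lt' one_pos).2 (by simpa using hμ)
  have : l = 0 := by nlinarith
  rwa [this] at hl

/-- A nonzero coordinate has been nonzero since the last update of its block. Before that update it
was bounded away from zero, as `ε` is small by then, and the steps are small too. -/
lemma IsBPIREeLp.eventually_eq_zero_or_le_abs (h : IsBPIREeLp f blk lam p ℓ L δ μ b β Lk x ε)
    (hμ : μ < 1) {T : ℕ} (hT : EssentiallyCyclic b T) {c : ℝ} (hc : 0 < c)
    (hlow : ∀ k j, blk j = b (k + 1) → x (k + 1) j ≠ 0 → c ≤ |x k j| + ε k j ^ 2)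
    (hd : Tendsto (fun k => dist (x k) (x (k + 1))) atTop (𝓝 0)) (j : Fin n) :
    ∀ᶠ k in atTop, x k j = 0 ∨ c / 2 ≤ |x k j| := by
  by_cases hj : ∃ᶠ k in atTop, x k j ≠ 0
  · have he : Tendsto (fun k => ε k j ^ 2) atTop (𝓝 0) := by
      simpa using (h.tendsto_eps hμ hj).pow 2
    obtain ⟨N, hN⟩ := eventually_atTop.1 ((he.eventually_lt_const (show 0 < c / 4 by linarith)).and
      (hd.eventually_lt_const (show 0 < c / 4 by linarith)))
    filter_upwards [eventually_ge_atTop (N + 1 + T)] with k hk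
    rw [or_iff_not_imp_left]
    intro hxk
    have hspec := hT.lastUpdate_spec (blk j) (k := k) (by omega)
    have hκ := h.apply_lastUpdate k j
    obtain ⟨κ, hκ'⟩ := Nat.exists_eq_succ_of_ne_zero (show lastUpdate b (blk j) k ≠ 0 by omega)
    rw [hκ'] at hκ hspec
    have h1 := hlow κ j hspec.2.2.symm (by rw [hκ]; exact hxk)
    obtain ⟨h2, h3⟩ := hN κ (by omega)
    have h4 : |x κ j - x (κ + 1) j| ≤ dist (x κ) (x (κ + 1)) := by
      rw [dist_eq_norm]; exact PiLp.norm_apply_le (x κ - x (κ + 1)) j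
    rw [← hκ]
    have h5 := abs_sub_abs_le_abs_sub (x κ j) (x (κ + 1) j)
    simp only [Nat.succ_eq_add_one]
    linarith
  · rw [not_frequently] at hj
    filter_upwards [hj] with k hk
    exact Or.inl (not_not.1 hk)

lemma eventually_nonzeroIdx_eq {c : ℝ} (hc : 0 < c)
    (h : ∀ j, ∀ᶠ k in atTop, x k j = 0 ∨ c ≤ |x k j|)
    (hd : Tendsto (fun k => dist (x k) (x (k + 1))) atTop (𝓝 0))
    {a : EuclideanSpace ℝ (Fin n)} (ha : MapClusterPt a atTop x) :
    ∀ᶠ k in atTop, nonzeroIdx (x k) = nonzeroIdx a := by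
  have key : ∀ j, ∀ᶠ k in atTop, (x k j ≠ 0 ↔ a j ≠ 0) := by
    intro j
    obtain ⟨N, hN⟩ := eventually_atTop.1 ((h j).and (hd.eventually_lt_const hc))
    have hstep : ∀ k ≥ N, (x (k + 1) j ≠ 0 ↔ x k j ≠ 0) := by
      intro k hk
      have h1 : |x k j - x (k + 1) j| < c := by
        refine lt_of_le_of_lt ?_ (hN k hk).2
        rw [dist_eq_norm]; exact PiLp.norm_apply_le (x k - x (k + 1)) j
      rw [not_iff_not]
      constructor <;> intro h0
      · rw [h0, sub_zero] at h1
        exact (hN k hk).1.resolve_right (not_le.2 h1)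
      · rw [h0, zero_sub, abs_neg] at h1
        exact (hN (k + 1) (by omega)).1.resolve_right (not_le.2 h1)
    have hconst : ∀ k ≥ N, (x k j ≠ 0 ↔ x N j ≠ 0) := by
      intro k hk
      induction k, hk using Nat.le_induction with
      | base => rfl
      | succ k hk ih => exact (hstep k hk).trans ih
    -- a radius which separates zero from nonzero values near `a j`
    obtain ⟨η, hη, hηc, hηa⟩ : ∃ η > 0, η ≤ c ∧ (a j ≠ 0 → η ≤ |a j|) := by
      by_cases h0 : a j = 0
      · exact ⟨c, hc, le_rfl, fun h1 => absurd h0 h1⟩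
      · exact ⟨min c |a j|, lt_min hc (abs_pos.2 h0), min_le_left _ _, fun _ => min_le_right _ _⟩
    obtain ⟨k, hk, hkN⟩ := ((mapClusterPt_iff_frequently.1 ha _
      (Metric.ball_mem_nhds a hη)).and_eventually (eventually_ge_atTop N)).exists
    have h2 : |x k j - a j| < η := by
      refine lt_of_le_of_lt ?_ (Metric.mem_ball.1 hk)
      rw [dist_eq_norm]; exact PiLp.norm_apply_le (x k - a) j
    have h3 : x k j ≠ 0 ↔ a j ≠ 0 := by
      constructor
      · intro h0 h1
        rw [h1, sub_zero] at h2
        exact absurd ((hN k hkN).1.resolve_left h0) (not_le.2 (h2.trans_le hηc))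
      · intro h0 h1
        rw [h1, zero_sub, abs_neg] at h2
        exact absurd (hηa h0) (not_le.2 h2)
    filter_upwards [eventually_ge_atTop N] with k' hk'
    rw [hconst k' hk', ← hconst k hkN, h3]
  filter_upwards [eventually_all.2 key] with k hk
  ext j
  simp [nonzeroIdx, hk j]

end Algorithm

/-! ### The reduced function and its gradient -/

section Reduced

variable {n : ℕ} {f : EuclideanSpace ℝ (Fin n) → ℝ} {lam p : ℝ} {I : Finset (Fin n)}

/-- Extension of the `x`-part of a point of `ℝ^{2|I|}` by zero outside `I`. -/
noncomputable def extendZero (I : Finset (Fin n)) :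
    EuclideanSpace ℝ (I ⊕ I) →L[ℝ] EuclideanSpace ℝ (Fin n) :=
  LinearMap.toContinuousLinearMap
    { toFun := fun z => WithLp.toLp 2 fun i => if h : i ∈ I then z (Sum.inl ⟨i, h⟩) else 0
      map_add' := fun u v => by
        ext i
        simp only [PiLp.add_apply]
        split_ifs <;> simp
      map_smul' := fun c u => by
        ext i
        simp only [PiLp.smul_apply, RingHom.id_apply]
        split_ifs <;> simp }

/-- The point `(u_I, e_I)` of `ℝ^{2|I|}`. -/
noncomputable def restrictPair (I : Finset (Fin n)) (u : EuclideanSpace ℝ (Fin n))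
    (e : Fin n → ℝ) : EuclideanSpace ℝ (I ⊕ I) :=
  WithLp.toLp 2 (Sum.elim (fun i => u i) fun i => e i)

/-- The gradient of the reduced function at the points whose `x`-part has no zero coordinate. -/
noncomputable def reducedGradient (f : EuclideanSpace ℝ (Fin n) → ℝ) (lam p : ℝ)
    (I : Finset (Fin n)) (z : EuclideanSpace ℝ (I ⊕ I)) : EuclideanSpace ℝ (I ⊕ I) :=
  WithLp.toLp 2 (Sum.elim
    (fun i => gradient f (extendZero I z) i +
      lam * (p * (|z (Sum.inl i)| + z (Sum.inr i) ^ 2) ^ (p - 1)) *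
        (SignType.sign (z (Sum.inl i)) : ℝ))
    fun i => lam * (p * (|z (Sum.inl i)| + z (Sum.inr i) ^ 2) ^ (p - 1)) * (2 * z (Sum.inr i)))

lemma extendZero_apply (z : EuclideanSpace ℝ (I ⊕ I)) (i : Fin n) :
    extendZero I z i = if h : i ∈ I then z (Sum.inl ⟨i, h⟩) else 0 := rfl

lemma extendZero_restrictPair {u : EuclideanSpace ℝ (Fin n)} (hu : ∀ j ∉ I, u j = 0)
    (e : Fin n → ℝ) : extendZero I (restrictPair I u e) = u := by
  ext j
  rw [extendZero_apply]
  split_ifs with hj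
  · rfl
  · exact (hu j hj).symm

lemma reducedObjective_eq (z : EuclideanSpace ℝ (I ⊕ I)) :
    reducedObjective f lam p I z =
      f (extendZero I z) + lam * ∑ i : I, (|z (Sum.inl i)| + z (Sum.inr i) ^ 2) ^ p := rfl

lemma objective_eq_reducedObjective_add {u : EuclideanSpace ℝ (Fin n)} (hu : ∀ j ∉ I, u j = 0)
    (e : Fin n → ℝ) : objective f lam p u e =
      reducedObjective f lam p I (restrictPair I u e) + lam * ∑ j ∈ Iᶜ, (e j ^ 2) ^ p := by
  rw [reducedObjective_eq, extendZero_restrictPair hu, objective, add_assoc, ← mul_add]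
  congr 2
  rw [← Finset.sum_add_sum_compl I, ← Finset.sum_coe_sort I]
  congr 1
  refine Finset.sum_congr rfl fun j hj => ?_
  rw [hu j (Finset.mem_compl.1 hj), abs_zero, zero_add]

lemma continuous_reducedObjective (hf : Continuous f) (hp : 0 < p) :
    Continuous (reducedObjective f lam p I) := by
  have : reducedObjective f lam p I = fun z => f (extendZero I z) +
      lam * ∑ i : I, (|z (Sum.inl i)| + z (Sum.inr i) ^ 2) ^ p := rfl
  rw [this]
  refine (hf.comp (extendZero I).continuous).add (continuous_const.mul
    (continuous_finsetSum _ fun i _ => ?_))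
  exact Continuous.rpow_const (by fun_prop) fun _ => Or.inr hp.le

lemma hasFDerivAt_reducedObjective (hf : ContDiff ℝ 1 f) {z : EuclideanSpace ℝ (I ⊕ I)}
    (hz : ∀ i : I, z (Sum.inl i) ≠ 0) :
    HasFDerivAt (reducedObjective f lam p I) (innerSL ℝ (reducedGradient f lam p I z)) z := by
  have h1 := (hasGradientAt_gradient hf (extendZero I z)).hasFDerivAt.comp z
    (extendZero I).hasFDerivAt
  have h2 : ∀ i ∈ (Finset.univ : Finset I), HasFDerivAt
      (fun z : EuclideanSpace ℝ (I ⊕ I) => (|z (Sum.inl i)| + z (Sum.inr i) ^ 2) ^ p)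
      ((p * (|z (Sum.inl i)| + z (Sum.inr i) ^ 2) ^ (p - 1)) •
        ((SignType.sign (z (Sum.inl i)) : ℝ) • EuclideanSpace.proj (𝕜 := ℝ) (Sum.inl i) +
        (2 * z (Sum.inr i)) • EuclideanSpace.proj (𝕜 := ℝ) (Sum.inr i))) z := by
    intro i _
    have e1 : HasFDerivAt (fun z : EuclideanSpace ℝ (I ⊕ I) => z (Sum.inl i))
        (EuclideanSpace.proj (𝕜 := ℝ) (Sum.inl i)) z :=
      (EuclideanSpace.proj (Sum.inl i) : EuclideanSpace ℝ (I ⊕ I) →L[ℝ] ℝ).hasFDerivAt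
    have e2 : HasFDerivAt (fun z : EuclideanSpace ℝ (I ⊕ I) => z (Sum.inr i))
        (EuclideanSpace.proj (𝕜 := ℝ) (Sum.inr i)) z :=
      (EuclideanSpace.proj (Sum.inr i) : EuclideanSpace ℝ (I ⊕ I) →L[ℝ] ℝ).hasFDerivAt
    have e3 := (hasDerivAt_abs (hz i)).comp_hasFDerivAt z e1
    have e4 := (hasDerivAt_pow 2 (z (Sum.inr i))).comp_hasFDerivAt z e2
    have hpos : |z (Sum.inl i)| + z (Sum.inr i) ^ 2 ≠ 0 := by
      have := abs_pos.2 (hz i); positivity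
    have e5 := (Real.hasDerivAt_rpow_const (p := p) (Or.inl hpos)).comp_hasFDerivAt z (e3.add e4)
    refine e5.congr_fderiv ?_
    simp
  have h3 := h1.add ((HasFDerivAt.fun_sum h2).const_mul lam)
  refine h3.congr_fderiv ?_
  ext v
  have e1 : inner ℝ (gradient f (extendZero I z)) (extendZero I v) =
      ∑ i : I, gradient f (extendZero I z) i * v (Sum.inl i) := by
    rw [PiLp.inner_apply, ← Finset.sum_add_sum_compl I, ← Finset.sum_coe_sort I]
    rw [Finset.sum_eq_zero (s := Iᶜ), add_zero]
    · refine Finset.sum_congr rfl fun i _ => ?_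
      rw [extendZero_apply, dif_pos i.2]
      simp [mul_comm]
    · intro j hj
      rw [extendZero_apply, dif_neg (Finset.mem_compl.1 hj)]
      simp
  have e2 : inner ℝ (reducedGradient f lam p I z) v =
      ∑ i : I, (gradient f (extendZero I z) i +
        lam * (p * (|z (Sum.inl i)| + z (Sum.inr i) ^ 2) ^ (p - 1)) *
        (SignType.sign (z (Sum.inl i)) : ℝ)) * v (Sum.inl i) +
      ∑ i : I, (lam * (p * (|z (Sum.inl i)| + z (Sum.inr i) ^ 2) ^ (p - 1)) *
        (2 * z (Sum.inr i))) * v (Sum.inr i) := by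
    rw [PiLp.inner_apply, Fintype.sum_sum_type]
    simp [reducedGradient, mul_comm]
  have hproj : ∀ s, EuclideanSpace.proj (𝕜 := ℝ) s v = v s := fun _ => rfl
  simp only [add_apply, ContinuousLinearMap.comp_apply,
    InnerProductSpace.toDual_apply_apply, innerSL_apply_apply, e1, e2,
    smul_apply, sum_apply, hproj,
    smul_eq_mul, Finset.mul_sum]
  rw [← Finset.sum_add_distrib, ← Finset.sum_add_distrib]
  refine Finset.sum_congr rfl fun i _ => ?_
  ring

lemma norm_le_card_mul {ι : Type*} [Fintype ι] {v : EuclideanSpace ℝ ι} {M : ℝ} (hM : 0 ≤ M)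
    (h : ∀ i, |v i| ≤ M) : ‖v‖ ≤ Fintype.card ι * M := by
  rw [EuclideanSpace.norm_eq]
  refine Real.sqrt_le_iff.2 ⟨by positivity, ?_⟩
  calc ∑ i, ‖v i‖ ^ 2 ≤ ∑ _i : ι, M ^ 2 := by
        refine Finset.sum_le_sum fun i _ => ?_
        rw [Real.norm_eq_abs]
        exact pow_le_pow_left₀ (abs_nonneg _) (h i) 2
    _ = Fintype.card ι * M ^ 2 := by simp
    _ ≤ (Fintype.card ι : ℝ) ^ 2 * M ^ 2 := by
        gcongr
        exact_mod_cast Nat.le_self_pow two_ne_zero _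
    _ = _ := by ring

lemma abs_rpow_sub_rpow_le {p c s t : ℝ} (hp : p < 1) (hc : 0 < c) (hs : c ≤ s) (ht : c ≤ t) :
    |s ^ (p - 1) - t ^ (p - 1)| ≤ (1 - p) * c ^ (p - 2) * |s - t| := by
  have h := (convex_Ici c).norm_image_sub_le_of_norm_hasDerivWithin_le
    (f := fun s : ℝ => s ^ (p - 1)) (f' := fun s => (p - 1) * s ^ (p - 1 - 1))
    (C := (1 - p) * c ^ (p - 2)) (x := t) (y := s)
    (fun u hu => (Real.hasDerivAt_rpow_const (Or.inl (hc.trans_le hu).ne')).hasDerivWithinAt)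
    (fun u hu => ?_) ht hs
  · simpa only [Real.norm_eq_abs] using h
  · have hu0 : 0 < u := hc.trans_le hu
    rw [Real.norm_eq_abs, abs_mul, abs_of_neg (by linarith), abs_of_pos (by positivity), neg_sub,
      show p - 1 - 1 = p - 2 by ring]
    refine mul_le_mul_of_nonneg_left ?_ (by linarith)
    exact Real.rpow_le_rpow_of_nonpos hc hu (by linarith)

lemma sign_eq_of_abs_sub_lt {a u : ℝ} (h : |u - a| < |a|) : SignType.sign u = SignType.sign a := by
  rcases lt_trichotomy a 0 with h0 | h0 | h0
  · rw [abs_of_neg h0, abs_lt] at h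
    rw [sign_neg h0, sign_neg (by linarith)]
  · subst h0
    simp only [abs_zero] at h
    exact absurd h (not_lt.2 (abs_nonneg _))
  · rw [abs_of_pos h0, abs_lt] at h
    rw [sign_pos h0, sign_pos (by linarith)]

end Reduced

/-! ### The gradient along the segments between consecutive iterates -/

section Algorithm

variable {n m : ℕ} {f : EuclideanSpace ℝ (Fin n) → ℝ} {blk : Fin n → Fin m}
    {lam p ℓ L δ μ : ℝ} {b : ℕ → Fin m} {β Lk : ℕ → ℝ} {x : ℕ → EuclideanSpace ℝ (Fin n)}
    {ε : ℕ → Fin n → ℝ} {T : ℕ}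

/-- The length of the path of the iterates over the last `2 * T + 1` steps up to `x^{k+1}`. In this
window every block is updated, and the extrapolation of its last update is also based on it. -/
noncomputable def windowLength (x : ℕ → EuclideanSpace ℝ (Fin n)) (T k : ℕ) : ℝ :=
  ∑ j ∈ Finset.Ico (k - 2 * T) (k + 1), dist (x j) (x (j + 1))

lemma windowLength_nonneg (k : ℕ) : 0 ≤ windowLength x T k :=
  Finset.sum_nonneg fun _ _ => dist_nonneg

lemma dist_le_windowLength {k a c : ℕ} (h1 : k - 2 * T ≤ a) (h2 : a ≤ c) (h3 : c ≤ k + 1) :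
    dist (x a) (x c) ≤ windowLength x T k :=
  (dist_le_Ico_sum_dist x h2).trans (Finset.sum_le_sum_of_subset_of_nonneg
    (Finset.Ico_subset_Ico h1 h3) fun _ _ _ => dist_nonneg)

lemma tendsto_windowLength (T : ℕ) (hd : Tendsto (fun k => dist (x k) (x (k + 1))) atTop (𝓝 0)) :
    Tendsto (windowLength x T) atTop (𝓝 0) := by
  have h1 : Tendsto (fun k => ∑ j ∈ Finset.range (2 * T + 1),
      dist (x (k - 2 * T + j)) (x (k - 2 * T + j + 1))) atTop (𝓝 0) := by
    have := tendsto_finsetSum (Finset.range (2 * T + 1)) fun j _ =>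
      hd.comp ((tendsto_add_atTop_nat j).comp (tendsto_sub_atTop_nat (2 * T)))
    simpa [Function.comp_def] using this
  refine h1.congr' ?_
  filter_upwards [eventually_ge_atTop (2 * T)] with k hk
  rw [windowLength, Finset.sum_Ico_eq_sum_range]
  congr 2
  omega

/-- The last update of the block of the coordinate `i`, and the points it involves. -/
lemma IsBPIREeLp.exists_last_update (h : IsBPIREeLp f blk lam p ℓ L δ μ b β Lk x ε)
    (hT : EssentiallyCyclic b T) {k : ℕ} (hk : 2 * T ≤ k) (i : Fin n) :
    ∃ κ, k ≤ κ + T ∧ κ + 1 ≤ k ∧ b (κ + 1) = blk i ∧ x (κ + 1) i = x k i ∧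
      dist (x κ) (x k) ≤ windowLength x T k ∧ dist (x κ) (x (κ + 1)) ≤ windowLength x T k ∧
      dist (extrapolated blk b β x κ) (x κ) ≤ windowLength x T k := by
  have hspec := hT.lastUpdate_spec (blk i) (k := k) (by omega)
  have hle := lastUpdate_le b (blk i) k
  have hxi := h.apply_lastUpdate k i
  obtain ⟨κ, hκ⟩ := Nat.exists_eq_succ_of_ne_zero (show lastUpdate b (blk i) k ≠ 0 by omega)
  rw [hκ] at hspec hle hxi
  rw [Nat.succ_eq_add_one] at *
  refine ⟨κ, by omega, hle, hspec.2.2, hxi, dist_le_windowLength (by omega) (by omega) (by omega),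
    dist_le_windowLength (by omega) (by omega) (by omega), ?_⟩
  have h1 := h.norm_extrapolated_sub_le κ
  have hspec' := hT.lastUpdate_spec (b (κ + 1)) (k := κ) (by omega)
  have hle' := lastUpdate_le b (b (κ + 1)) κ
  rw [dist_eq_norm]
  refine h1.trans ?_
  rw [← dist_eq_norm, dist_comm]
  exact (mul_le_of_le_one_left dist_nonneg (h.beta_mem κ).2).trans
    (dist_le_windowLength (by omega) (by omega) (by omega))

/-- The partial derivative of the penalized objective at `(u, e)` with respect to the coordinate
`j`, compared with the one that vanishes by optimality of the update `κ + 1`. -/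
lemma IsBPIREeLp.abs_partial_le (h : IsBPIREeLp f blk lam p ℓ L δ μ b β Lk x ε)
    (hℓ : 0 < ℓ) (hlam : 0 < lam) (hp : 0 < p ∧ p < 1) {c : ℝ} (hc : 0 < c) {κ : ℕ} {j : Fin n}
    (hj : blk j = b (κ + 1)) (hne : x (κ + 1) j ≠ 0) {u : EuclideanSpace ℝ (Fin n)}
    {e W η LG : ℝ} (hgrad : ‖blockPart blk (blk j) (gradient f u -
      gradient f (extrapolated blk b β x κ))‖ ≤ LG * ‖u - extrapolated blk b β x κ‖)
    (huy : dist u (extrapolated blk b β x κ) ≤ 3 * W)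
    (hxy : dist (x (κ + 1)) (extrapolated blk b β x κ) ≤ 2 * W) (hux : dist u (x κ) ≤ 2 * W)
    (hs : c ≤ |u j| + e ^ 2) (hs' : c ≤ |x κ j| + ε κ j ^ 2) (he : |e ^ 2 - ε κ j ^ 2| ≤ η)
    (hsign : SignType.sign (u j) = SignType.sign (x (κ + 1) j)) :
    |gradient f u j + lam * (p * (|u j| + e ^ 2) ^ (p - 1)) * (SignType.sign (u j) : ℝ)| ≤
      |LG| * (3 * W) + 2 * L * (2 * W) +
        lam * (p * ((1 - p) * c ^ (p - 2))) * (2 * W + η) := by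
  have hp0 := hp.1
  have hp1 : 0 < 1 - p := by linarith [hp.2]
  have hst := subproblem_stationary (h.selected κ) hj hne
  set y := extrapolated blk b β x κ
  have hcoord : ∀ (v w : EuclideanSpace ℝ (Fin n)), |v j - w j| ≤ dist v w :=
    fun v w => by rw [dist_eq_norm]; exact PiLp.norm_apply_le (v - w) j
  have g1 : |gradient f u j - gradient f y j| ≤ |LG| * (3 * W) := by
    have h1 := PiLp.norm_apply_le (blockPart blk (blk j) (gradient f u - gradient f y)) j
    rw [blockPart_apply, if_pos rfl, PiLp.sub_apply, Real.norm_eq_abs] at h1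
    refine (h1.trans hgrad).trans ?_
    rw [← dist_eq_norm]
    exact mul_le_mul (le_abs_self LG) huy dist_nonneg (abs_nonneg LG)
  have g2 : |2 * Lk (κ + 1) * (x (κ + 1) j - y j)| ≤ 2 * L * (2 * W) := by
    have e1 := h.Lk_pos hℓ κ
    have e2 := (h.lip_const κ).2.1
    have e3 := (hcoord (x (κ + 1)) y).trans hxy
    rw [abs_mul, abs_of_pos (by positivity)]
    exact mul_le_mul (by linarith) e3 (abs_nonneg _) (by linarith)
  have g3 : |lam * (p * (|u j| + e ^ 2) ^ (p - 1)) - weight lam p (x κ) (ε κ) j| ≤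
      lam * (p * ((1 - p) * c ^ (p - 2))) * (2 * W + η) := by
    have h1 := abs_rpow_sub_rpow_le hp.2 hc hs hs'
    have h2 : |(|u j| + e ^ 2) - (|x κ j| + ε κ j ^ 2)| ≤ 2 * W + η := by
      rw [add_sub_add_comm]
      exact (abs_add_le _ _).trans (add_le_add
        ((abs_abs_sub_abs_le_abs_sub _ _).trans ((hcoord u (x κ)).trans hux)) he)
    rw [weight, ← mul_sub, ← mul_sub, abs_mul, abs_mul, abs_of_pos hlam, abs_of_pos hp0]
    calc lam * (p * |(|u j| + e ^ 2) ^ (p - 1) - (|x κ j| + ε κ j ^ 2) ^ (p - 1)|)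
        ≤ lam * (p * ((1 - p) * c ^ (p - 2) * (2 * W + η))) := by
          gcongr
          exact h1.trans (by gcongr)
      _ = _ := by ring
  rw [hsign]
  set σ := (SignType.sign (x (κ + 1) j) : ℝ) with hσ
  have hσ1 : |σ| ≤ 1 := by
    rcases lt_trichotomy (x (κ + 1) j) 0 with h0 | h0 | h0 <;> simp [hσ, h0]
  have g4 : |(lam * (p * (|u j| + e ^ 2) ^ (p - 1)) - weight lam p (x κ) (ε κ) j) * σ| ≤
      lam * (p * ((1 - p) * c ^ (p - 2))) * (2 * W + η) := by
    rw [abs_mul]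
    exact (mul_le_of_le_one_right (abs_nonneg _) hσ1).trans g3
  have hsplit : gradient f u j + lam * (p * (|u j| + e ^ 2) ^ (p - 1)) * σ =
      (gradient f u j - gradient f y j) - 2 * Lk (κ + 1) * (x (κ + 1) j - y j) +
      (lam * (p * (|u j| + e ^ 2) ^ (p - 1)) - weight lam p (x κ) (ε κ) j) * σ := by
    linear_combination hst
  rw [hsplit]
  exact (abs_add_le _ _).trans (add_le_add ((abs_sub _ _).trans (add_le_add g1 g2)) g4)

/-- On the segment between consecutive iterates near `a`, the gradient of the reduced function is
bounded by the recent steps and a geometrically decaying term: the optimality condition of the last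
update of each coordinate is subtracted from the corresponding partial derivative. -/
lemma IsBPIREeLp.exists_norm_reducedGradient_le
    (h : IsBPIREeLp f blk lam p ℓ L δ μ b β Lk x ε) (hℓ : 0 < ℓ) (hlam : 0 < lam)
    (hp : 0 < p ∧ p < 1) (hμ : 0 < μ ∧ μ < 1) (hT : EssentiallyCyclic b T)
    (hd : Tendsto (fun k => dist (x k) (x (k + 1))) atTop (𝓝 0))
    {a : EuclideanSpace ℝ (Fin n)} {ρ LG : ℝ} (hρ : 0 < ρ)
    (hLG : ∀ i, ∀ y ∈ Metric.ball a (4 * ρ), ∀ z ∈ Metric.ball a (4 * ρ),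
      ‖blockPart blk i (gradient f y - gradient f z)‖ ≤ LG * ‖y - z‖)
    {I : Finset (Fin n)} {c : ℝ} (hc : 0 < c) (hI : ∀ j ∈ I, 4 * c ≤ |a j|) {E : ℝ}
    (hE : ∀ᶠ k in atTop, ∀ j ∈ I, ε k j ≤ E * √μ ^ k) :
    ∃ r > 0, ∃ C > 0, ∀ᶠ k in atTop, x k ∈ Metric.ball a r →
      ∀ t ∈ Set.Icc (0 : ℝ) 1, ∀ u : EuclideanSpace ℝ (Fin n), ∀ e : Fin n → ℝ,
        u = x k + t • (x (k + 1) - x k) → e = ε k + t • (ε (k + 1) - ε k) →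
        (∀ j ∉ I, u j = 0) → (∀ j ∈ I, u j ≠ 0) ∧
        ‖reducedGradient f lam p I (restrictPair I u e)‖ ≤
          C * (windowLength x T k + √μ ^ k) := by
  have hL : 0 < L := hℓ.trans_le ((h.lip_const 0).1.trans (h.lip_const 0).2.1)
  have hp0 := hp.1
  have hp1 : 0 < 1 - p := by linarith [hp.2]
  set q := √μ with hq
  have hq0 : 0 < q := Real.sqrt_pos.2 hμ.1
  have hq1 : q < 1 := (Real.sqrt_lt' one_pos).2 (by simpa using hμ.2)
  set E' := |E| / q ^ T with hE'
  set C₁ := lam * (p * ((1 - p) * c ^ (p - 2))) with hC₁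
  set C₂ := lam * (p * c ^ (p - 1)) with hC₂
  set M := 3 * |LG| + 4 * L + 2 * C₁ + C₁ * E' + 2 * C₂ * E' with hM
  have hC₁0 : 0 ≤ C₁ := by positivity
  have hC₂0 : 0 ≤ C₂ := by positivity
  have hE'0 : 0 ≤ E' := by positivity
  have hM0 : 0 < M := by positivity
  clear_value M C₁ C₂ q
  refine ⟨min ρ c, lt_min hρ hc, (Fintype.card (I ⊕ I) + 1) * M, by positivity, ?_⟩
  have hqT : Tendsto (fun k => E' * q ^ k) atTop (𝓝 0) := by
    simpa using (tendsto_pow_atTop_nhds_zero_of_lt_one hq0.le hq1).const_mul E'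
  obtain ⟨N, hN⟩ := eventually_atTop.1 hE
  filter_upwards [(tendsto_windowLength T hd).eventually_lt_const (lt_min hρ hc),
    hqT.eventually_lt_const one_pos, eventually_ge_atTop (N + 2 * T)] with k hW hq1' hk
  intro hxk t ht u e hu he huI
  set W := windowLength x T k with hWdef
  have hW0 : 0 ≤ W := windowLength_nonneg k
  have hqk : 0 < q ^ k := by positivity
  rw [Metric.mem_ball] at hxk
  have hxρ := hxk.trans_le (min_le_left _ _)
  have hxc := hxk.trans_le (min_le_right _ _)
  have hWρ := hW.trans_le (min_le_left _ _)
  have hWc := hW.trans_le (min_le_right _ _)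
  have hcoord : ∀ (v w : EuclideanSpace ℝ (Fin n)) (j : Fin n), |v j - w j| ≤ dist v w :=
    fun v w j => by rw [dist_eq_norm]; exact PiLp.norm_apply_le (v - w) j
  have hux : dist u (x k) ≤ W := by
    rw [hu, dist_eq_norm, add_sub_cancel_left, norm_smul, Real.norm_of_nonneg ht.1,
      ← dist_eq_norm, dist_comm]
    exact (mul_le_of_le_one_left dist_nonneg ht.2).trans
      (dist_le_windowLength (by omega) (by omega) le_rfl)
  have hua : dist u a < 2 * c := by linarith [dist_triangle u (x k) a]
  have huc : ∀ j ∈ I, 2 * c ≤ |u j| ∧ SignType.sign (u j) = SignType.sign (a j) := by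
    intro j hj
    have h1 := (hcoord u a j).trans_lt hua
    have h2 := hI j hj
    refine ⟨?_, sign_eq_of_abs_sub_lt (by linarith)⟩
    have h3 := abs_sub_abs_le_abs_sub (a j) (u j)
    rw [abs_sub_comm] at h3
    linarith
  refine ⟨fun j hj h0 => ?_, ?_⟩
  · have := (huc j hj).1
    rw [h0, abs_zero] at this
    linarith
  -- the smoothing parameters on the segment, compared with those of an iteration `κ` at most `T`
  -- earlier; the factor `q ^ (-T)` in `E'` pays for the delay
  have heps : ∀ j ∈ I, ∀ κ, k ≤ κ + T → κ ≤ k → 0 ≤ e j ∧ e j ≤ ε κ j ∧ ε κ j ≤ E' * q ^ k := by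
    intro j hj κ h1 h2
    have hanti : Antitone fun k => ε k j := antitone_nat_of_succ_le fun k => h.eps_le hμ.2 k j
    have h3 := h.eps_pos (k + 1) j
    have h4 := h.eps_le hμ.2 k j
    have h5 : ε k j ≤ ε κ j := hanti h2
    have h6 : e j = ε k j + t * (ε (k + 1) j - ε k j) := by rw [he]; rfl
    have h7 : E * q ^ κ ≤ E' * q ^ k := by
      rw [hE', div_mul_eq_mul_div, le_div_iff₀ (by positivity), mul_assoc, ← pow_add]
      exact mul_le_mul (le_abs_self E) (pow_le_pow_of_le_one hq0.le hq1.le h1) (by positivity)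
        (abs_nonneg E)
    refine ⟨?_, ?_, (hN κ (by omega) j hj).trans h7⟩
    · rw [h6]; nlinarith [ht.1, ht.2]
    · rw [h6]; nlinarith [ht.1, ht.2]
  have hs : ∀ j ∈ I, c ≤ |u j| + e j ^ 2 := fun j hj => by
    linarith [(huc j hj).1, sq_nonneg (e j)]
  have hcomp : ∀ i, |reducedGradient f lam p I (restrictPair I u e) i| ≤ M * (W + q ^ k) := by
    rintro (⟨j, hj⟩ | ⟨j, hj⟩)
    · change |gradient f (extendZero I (restrictPair I u e)) j +
        lam * (p * (|u j| + e j ^ 2) ^ (p - 1)) * (SignType.sign (u j) : ℝ)| ≤ _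
      rw [extendZero_restrictPair huI]
      obtain ⟨κ, hκ1, hκ2, hbκ, hxκ, hd1, hd2, hd3⟩ := h.exists_last_update hT (k := k) (by omega) j
      set y := extrapolated blk b β x κ with hy
      have hxka : |x k j - a j| < c := (hcoord _ _ _).trans_lt hxc
      have haj := hI j hj
      have hsx : SignType.sign (x (κ + 1) j) = SignType.sign (a j) := by
        rw [hxκ]; exact sign_eq_of_abs_sub_lt (by linarith)
      have hxne : x (κ + 1) j ≠ 0 := by
        rw [← sign_ne_zero, hsx, sign_ne_zero, ← abs_pos]
        linarith
      have hxκc : c ≤ |x κ j| + ε κ j ^ 2 := by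
        have h1 := hcoord (x κ) (x k) j
        have h2 := abs_sub_abs_le_abs_sub (a j) (x κ j)
        have h3 := abs_sub_le (a j) (x k j) (x κ j)
        rw [abs_sub_comm (a j) (x k j), abs_sub_comm (x k j) (x κ j)] at h3
        linarith [sq_nonneg (ε κ j)]
      obtain ⟨e1, e2, e3⟩ := heps j hj κ hκ1 (by omega)
      have h4 : |e j ^ 2 - ε κ j ^ 2| ≤ E' * q ^ k := by
        rw [abs_le]
        have e4 := pow_le_pow_left₀ e1 e2 2
        have e5 : ε κ j ^ 2 ≤ ε κ j := by
          rw [sq]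
          exact mul_le_of_le_one_left (e1.trans e2) (e3.trans hq1'.le)
        have e6 := sq_nonneg (e j)
        constructor <;> linarith
      have hub : u ∈ Metric.ball a (4 * ρ) := by
        rw [Metric.mem_ball]
        linarith [dist_triangle u (x k) a]
      have hyb : y ∈ Metric.ball a (4 * ρ) := by
        rw [Metric.mem_ball]
        linarith [dist_triangle y (x κ) a, dist_triangle (x κ) (x k) a]
      have huκ : dist u (x κ) ≤ 2 * W := by linarith [dist_triangle_right u (x κ) (x k)]
      refine (h.abs_partial_le hℓ hlam hp hc hbκ.symm hxne (hLG (blk j) u hub y hyb)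
        (W := W) (by linarith [dist_triangle_right u y (x κ)])
        (by linarith [dist_triangle_left (x (κ + 1)) y (x κ), dist_comm (x κ) y])
        huκ (hs j hj) hxκc h4 ((huc j hj).2.trans hsx.symm)).trans ?_
      rw [← hC₁, hM]
      have k1 : 0 ≤ |LG| * q ^ k := by positivity
      have k2 : 0 ≤ L * q ^ k := by positivity
      have k3 : 0 ≤ C₁ * q ^ k := by positivity
      have k4 : 0 ≤ C₁ * E' * W := by positivity
      have k5 : 0 ≤ 2 * C₂ * E' * (W + q ^ k) := by positivity
      linarith
    · change |lam * (p * (|u j| + e j ^ 2) ^ (p - 1)) * (2 * e j)| ≤ _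
      obtain ⟨e1, e2, e3⟩ := heps j hj k (by omega) le_rfl
      have hsj := hs j hj
      have hs0 : 0 < |u j| + e j ^ 2 := hc.trans_le hsj
      rw [abs_of_nonneg (by positivity)]
      have h1 : (|u j| + e j ^ 2) ^ (p - 1) ≤ c ^ (p - 1) :=
        Real.rpow_le_rpow_of_nonpos hc hsj (by linarith)
      calc lam * (p * (|u j| + e j ^ 2) ^ (p - 1)) * (2 * e j)
          ≤ lam * (p * c ^ (p - 1)) * (2 * (E' * q ^ k)) := by
            gcongr
            exact e2.trans e3
        _ = 2 * C₂ * E' * q ^ k := by rw [hC₂]; ring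
        _ ≤ M * (W + q ^ k) := by
            refine mul_le_mul ?_ (by linarith) hqk.le hM0.le
            rw [hM]
            have : 0 ≤ 3 * |LG| + 4 * L + 2 * C₁ + C₁ * E' := by positivity
            linarith
  refine (norm_le_card_mul (by positivity) hcomp).trans ?_
  rw [mul_assoc]
  gcongr
  linarith

end Algorithm

/-! ### Convergence -/

section Algorithm

variable {n m : ℕ} {f : EuclideanSpace ℝ (Fin n) → ℝ} {blk : Fin n → Fin m}
    {lam p ℓ L δ μ : ℝ} {b : ℕ → Fin m} {β Lk : ℕ → ℝ} {x : ℕ → EuclideanSpace ℝ (Fin n)}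
    {ε : ℕ → Fin n → ℝ} {T : ℕ}

lemma IsBPIREeLp.exists_eps_le (h : IsBPIREeLp f blk lam p ℓ L δ μ b β Lk x ε) (hμ : 0 < μ)
    {I : Finset (Fin n)} (hI : ∀ᶠ k in atTop, ∀ j ∈ I, x k j ≠ 0) :
    ∃ E, ∀ᶠ k in atTop, ∀ j ∈ I, ε k j ≤ E * √μ ^ k := by
  obtain ⟨N, hN⟩ := eventually_atTop.1 hI
  have hq : 0 < √μ := Real.sqrt_pos.2 hμ
  refine ⟨(∑ j ∈ I, ε N j) / √μ ^ N, ?_⟩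
  filter_upwards [eventually_ge_atTop N] with k hk j hj
  rw [div_mul_eq_mul_div, le_div_iff₀ (by positivity)]
  induction k, hk using Nat.le_induction with
  | base =>
    have := Finset.single_le_sum (f := fun j => ε N j) (fun i _ => (h.eps_pos N i).le) hj
    gcongr
  | succ k hk ih =>
    have h1 := h.eps_of_ne_zero k j (hN (k + 1) (by omega) j hj)
    calc ε (k + 1) j * √μ ^ N ≤ √μ * ε k j * √μ ^ N := by gcongr
      _ = √μ * (ε k j * √μ ^ N) := by ring
      _ ≤ √μ * ((∑ j ∈ I, ε N j) * √μ ^ k) := by gcongr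
      _ = _ := by ring

lemma restrictPair_mem_ball {I : Finset (Fin n)} {a u : EuclideanSpace ℝ (Fin n)} {e : Fin n → ℝ}
    {r : ℝ} (hr : 0 < r) (hu : dist u a ≤ r / (Fintype.card (I ⊕ I) + 1))
    (he : ∀ j ∈ I, |e j| ≤ r / (Fintype.card (I ⊕ I) + 1)) :
    restrictPair I u e ∈ Metric.ball (restrictPair I a 0) r := by
  rw [Metric.mem_ball, dist_eq_norm]
  have h1 : ‖restrictPair I u e - restrictPair I a 0‖ ≤
      Fintype.card (I ⊕ I) * (r / (Fintype.card (I ⊕ I) + 1)) := by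
    refine norm_le_card_mul (by positivity) ?_
    rintro (⟨j, hj⟩ | ⟨j, hj⟩)
    · rw [dist_eq_norm] at hu
      exact (PiLp.norm_apply_le (u - a) j).trans hu
    · simpa [restrictPair] using he j hj
  refine h1.trans_lt ?_
  rw [mul_div_assoc', div_lt_iff₀ (by positivity)]
  nlinarith

/-- Once the support of the iterates is `I`, the reduced function decreases along the iterates by
the same amount as the objective, because the parameters outside `I` are frozen. -/
lemma IsBPIREeLp.reducedObjective_sub (h : IsBPIREeLp f blk lam p ℓ L δ μ b β Lk x ε)
    {I : Finset (Fin n)} {k : ℕ} (h0 : ∀ j ∉ I, x k j = 0) (h1 : ∀ j ∉ I, x (k + 1) j = 0) :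
    reducedObjective f lam p I (restrictPair I (x k) (ε k)) -
        reducedObjective f lam p I (restrictPair I (x (k + 1)) (ε (k + 1))) =
      objective f lam p (x k) (ε k) - objective f lam p (x (k + 1)) (ε (k + 1)) := by
  rw [objective_eq_reducedObjective_add h0, objective_eq_reducedObjective_add h1]
  have : ∑ j ∈ Iᶜ, (ε (k + 1) j ^ 2) ^ p = ∑ j ∈ Iᶜ, (ε k j ^ 2) ^ p :=
    Finset.sum_congr rfl fun j hj => by
      rw [h.eps_of_eq_zero k j (h1 j (Finset.mem_compl.1 hj))]
  rw [this]
  ring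

lemma IsBPIREeLp.tendsto_reducedObjective (h : IsBPIREeLp f blk lam p ℓ L δ μ b β Lk x ε)
    (hF : ProblemAssumption f blk lam p ℓ L) (hlam : 0 < lam) (hp : 0 < p)
    (hdesc : Antitone fun k => objective f lam p (x k) (ε k))
    {a : EuclideanSpace ℝ (Fin n)} (ha : MapClusterPt a atTop x) {I : Finset (Fin n)}
    (h0 : ∀ᶠ k in atTop, ∀ j ∉ I, x k j = 0)
    (hε : ∀ j ∈ I, Tendsto (fun k => ε k j) atTop (𝓝 0)) :
    Tendsto (fun k => reducedObjective f lam p I (restrictPair I (x k) (ε k))) atTop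
      (𝓝 (reducedObjective f lam p I (restrictPair I a 0))) := by
  obtain ⟨c, hc⟩ := hF.bddBelow_objective hlam hp hdesc
  obtain ⟨l, hl⟩ := tendsto_of_antitone_of_le hdesc hc
  obtain ⟨N, hN⟩ := eventually_atTop.1 h0
  set J := fun k => reducedObjective f lam p I (restrictPair I (x k) (ε k)) with hJ
  obtain ⟨l', hl'⟩ : ∃ l', Tendsto J atTop (𝓝 l') := by
    have hconst : ∀ k ≥ N, objective f lam p (x k) (ε k) + (J N - objective f lam p (x N) (ε N)) =
        J k := by
      intro k hk
      induction k, hk using Nat.le_induction with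
      | base => ring
      | succ k hk ih =>
        have := h.reducedObjective_sub (hN k hk) (hN (k + 1) (by omega))
        simp only [hJ] at ih ⊢
        linarith
    refine ⟨_, (hl.add_const (J N - objective f lam p (x N) (ε N))).congr' ?_⟩
    filter_upwards [eventually_ge_atTop N] with k hk using hconst k hk
  obtain ⟨φ, hφ, hφx⟩ := ha.tendsto_subseq
  have hz : Tendsto (fun k => restrictPair I (x (φ k)) (ε (φ k))) atTop
      (𝓝 (restrictPair I a 0)) := by
    refine (PiLp.continuous_toLp 2 _).continuousAt.tendsto.comp (tendsto_pi_nhds.2 ?_)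
    rintro (⟨j, hj⟩ | ⟨j, hj⟩)
    · exact ((EuclideanSpace.proj (𝕜 := ℝ) j).continuous.tendsto a).comp hφx
    · exact (hε j hj).comp hφ.tendsto_atTop
  have h1 := ((continuous_reducedObjective (lam := lam) hF.contDiff.continuous hp).tendsto _).comp hz
  rw [← tendsto_nhds_unique (hl'.comp hφ.tendsto_atTop) h1]
  exact hl'

/-- Convergence of the iterates once their support has settled. -/
lemma IsBPIREeLp.tendsto_of_support (h : IsBPIREeLp f blk lam p ℓ L δ μ b β Lk x ε)
    (hF : ProblemAssumption f blk lam p ℓ L) (hlam : 0 < lam) (hp : 0 < p ∧ p < 1) (hδ : δ < 1)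
    (hμ : 0 < μ ∧ μ < 1) (hT : EssentiallyCyclic b T)
    (hdesc : Antitone fun k => objective f lam p (x k) (ε k))
    {a : EuclideanSpace ℝ (Fin n)} (ha : MapClusterPt a atTop x) {ρ LG : ℝ} (hρ : 0 < ρ)
    (hLG : ∀ i, ∀ y ∈ Metric.ball a (4 * ρ), ∀ z ∈ Metric.ball a (4 * ρ),
      ‖blockPart blk i (gradient f y - gradient f z)‖ ≤ LG * ‖y - z‖)
    {I : Finset (Fin n)} (hI : ∀ j ∈ I, a j ≠ 0) (hxI : ∀ᶠ k in atTop, nonzeroIdx (x k) = I)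
    (hKL : HasKLProperty (reducedObjective f lam p I) (restrictPair I a 0)) :
    Tendsto x atTop (𝓝 a) := by
  have hstep := h.tendsto_scaledStep hF hlam hp hδ hμ.2 hdesc
  have hd := h.tendsto_dist hF.pos hstep
  have hmem : ∀ᶠ k in atTop, ∀ j ∈ I, x k j ≠ 0 := hxI.mono fun k hk j hj => by
    rw [← hk] at hj; simpa [nonzeroIdx] using hj
  have hnot : ∀ᶠ k in atTop, ∀ j ∉ I, x k j = 0 := hxI.mono fun k hk j hj => by
    rw [← hk] at hj; simpa [nonzeroIdx] using hj
  have hε : ∀ j ∈ I, Tendsto (fun k => ε k j) atTop (𝓝 0) := fun j hj =>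
    h.tendsto_eps hμ.2 (hmem.mono fun k hk => hk j hj).frequently
  obtain ⟨E, hE⟩ := h.exists_eps_le hμ.1 hmem
  obtain ⟨c, hc, hcI⟩ : ∃ c : ℝ, 0 < c ∧ ∀ j ∈ I, 4 * c ≤ |a j| := by
    have h1 : ∀ᶠ c in 𝓝[>] (0 : ℝ), ∀ j ∈ I, 4 * c ≤ |a j| := by
      refine (eventually_all_finset I).2 fun j hj => ?_
      have h2 : 0 < |a j| / 4 := by have := abs_pos.2 (hI j hj); positivity
      filter_upwards [Ioo_mem_nhdsGT h2] with c hc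
      linarith [hc.2]
    obtain ⟨c, hc, hc'⟩ := (h1.and self_mem_nhdsWithin).exists
    exact ⟨c, hc', hc⟩
  obtain ⟨r₁, hr₁, C, hC, hgrad⟩ :=
    h.exists_norm_reducedGradient_le hF.pos hlam hp hμ hT hd hρ hLG hc hcI hE
  obtain ⟨r₂, hr₂, ξ, hξ, ψ, hψ0, hψt, hψ⟩ := hKL.exists_desingularizing
  have hJt := h.tendsto_reducedObjective hF hlam hp.1 hdesc ha hnot hε
  set z := fun k => restrictPair I (x k) (ε k) with hz
  set J := reducedObjective f lam p I with hJ
  set Jb := J (restrictPair I a 0)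
  set q := √μ with hq
  have hq0 : 0 < q := Real.sqrt_pos.2 hμ.1
  have hq1 : q < 1 := (Real.sqrt_lt' one_pos).2 (by simpa using hμ.2)
  have hJle : ∀ᶠ k in atTop, Jb ≤ J (z k) := by
    obtain ⟨N, hN⟩ := eventually_atTop.1 hnot
    have hanti : ∀ k ≥ N, J (z (k + 1)) ≤ J (z k) := fun k hk => by
      have h1 := h.reducedObjective_sub (hN k hk) (hN (k + 1) (by omega))
      have h2 := hdesc (Nat.le_succ k)
      simp only [Nat.succ_eq_add_one] at h2
      simp only [hz, hJ]
      linarith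
    filter_upwards [eventually_ge_atTop N] with k hk
    refine le_of_tendsto hJt ?_
    filter_upwards [eventually_ge_atTop k] with k' hk'
    induction k', hk' using Nat.le_induction with
    | base => exact le_rfl
    | succ k' hk' ih => exact (hanti k' (le_trans hk hk')).trans ih
  set u := fun k => ψ (J (z k) - Jb) with hu
  have hu0 : Tendsto u atTop (𝓝 0) := by
    refine hψt.comp (tendsto_nhdsWithin_iff.2 ⟨?_, ?_⟩)
    · simpa using hJt.sub_const Jb
    · filter_upwards [hJle] with k hk
      exact sub_nonneg.2 hk
  have hJξ : ∀ᶠ k in atTop, J (z k) < Jb + ξ := hJt.eventually_lt_const (by linarith)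
  set r₃ := r₂ / (Fintype.card (I ⊕ I) + 1) with hr₃
  have hr₃0 : 0 < r₃ := by positivity
  have hεr : ∀ᶠ k in atTop, ∀ j ∈ I, |ε k j| ≤ r₃ := by
    refine (eventually_all_finset I).2 fun j hj => ?_
    have h1 : Tendsto (fun k => |ε k j|) atTop (𝓝 0) := by simpa using (hε j hj).abs
    exact (h1.eventually_lt_const hr₃0).mono fun k hk => hk.le
  set A := fun k => windowLength x T k + q ^ k with hA
  have hA0 : ∀ k, 0 < A k := fun k => by
    have := windowLength_nonneg (x := x) (T := T) k
    positivity
  set r := min r₁ (r₃ / 2) with hr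
  have hr0 : 0 < r := by positivity
  -- the Kurdyka-Lojasiewicz inequality on the segment from `z k` to `z (k + 1)`
  have hdec : ∀ᶠ k in atTop, x k ∈ Metric.ball a r →
      J (z k) - J (z (k + 1)) ≤ C * A k * (u k - u (k + 1)) := by
    filter_upwards [hgrad, hJle, (tendsto_add_atTop_nat 1).eventually hJle, hJξ, hεr,
      (tendsto_add_atTop_nat 1).eventually hεr, hd.eventually_lt_const (half_pos hr₃0), hnot,
      (tendsto_add_atTop_nat 1).eventually hnot] with k hg hJ0 hJ1 hJx he0 he1 hdk hn0 hn1 hxk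
    have hmono : J (z (k + 1)) ≤ J (z k) := by
      have h1 := h.reducedObjective_sub hn0 hn1
      have h2 := hdesc (Nat.le_succ k)
      simp only [Nat.succ_eq_add_one] at h2
      simp only [hz, hJ]
      linarith
    have hxk' : dist (x k) a < r₃ / 2 := (Metric.mem_ball.1 hxk).trans_le (min_le_right _ _)
    have hz0 : z k ∈ Metric.ball (restrictPair I a 0) r₂ :=
      restrictPair_mem_ball hr₂ (by rw [← hr₃]; linarith) he0
    have hz1 : z (k + 1) ∈ Metric.ball (restrictPair I a 0) r₂ :=
      restrictPair_mem_ball hr₂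
        (by rw [← hr₃]; linarith [dist_triangle_left (x (k + 1)) a (x k)]) he1
    have key := hψ (J (z (k + 1)) - Jb) (J (z k) - Jb) (C * A k) (sub_nonneg.2 hJ1)
      (by linarith) (by linarith) (mul_pos hC (hA0 k)) ?_
    · simpa using key
    intro τ hτ
    have hcont : ContinuousOn (fun t : ℝ => J (z k + t • (z (k + 1) - z k))) (Set.Icc 0 1) :=
      ((continuous_reducedObjective hF.contDiff.continuous hp.1).comp
        (by fun_prop)).continuousOn
    obtain ⟨t, ht, htτ⟩ := intermediate_value_Icc' zero_le_one hcont
      (show Jb + τ ∈ _ by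
        simp only [zero_smul, one_smul, add_zero, add_sub_cancel]
        exact ⟨by linarith [hτ.1], by linarith [hτ.2]⟩)
    have hseg : z k + t • (z (k + 1) - z k) = restrictPair I (x k + t • (x (k + 1) - x k))
        (ε k + t • (ε (k + 1) - ε k)) := by
      ext (j | j) <;> simp [hz, restrictPair]
    obtain ⟨g1, g2⟩ := hg (Metric.ball_subset_ball (min_le_left _ _) hxk) t ht _ _ rfl rfl
      (fun j hj => by simp [hn0 j hj, hn1 j hj])
    refine ⟨z k + t • (z (k + 1) - z k), (convex_ball _ _).add_smul_sub_mem hz0 hz1 ht, _, htτ,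
      ?_, g2⟩
    rw [hseg]
    exact hasFDerivAt_reducedObjective hF.contDiff fun i => g1 i i.2
  -- small enough for the sums over the windows to be absorbed
  set η := √ℓ / (8 * (2 * T + 1)) with hη
  have hℓ0 : 0 < √ℓ := Real.sqrt_pos.2 hF.pos
  have hη0 : 0 < η := by positivity
  obtain ⟨K, hK⟩ := eventually_atTop.1 (hdec.and (hnot.and (hJle.and hJξ)))
  have hu_nonneg : ∀ k ≥ K, 0 ≤ u k := fun k hk =>
    hψ0 _ (sub_nonneg.2 (hK k hk).2.2.1) (by linarith [(hK k hk).2.2.2])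
  set B : ℕ → ℝ := fun K₀ => (4 * (1 / 2 * lastSum b (scaledStep Lk x) K₀ +
    η * ((2 * T + 1) * windowLength x T K₀ + q ^ K₀ / (1 - q)) + C / (2 * η) * u K₀)) / √ℓ with hB
  have hBt : Tendsto B atTop (𝓝 0) := by
    have h1 := (hT.tendsto_lastSum hstep).const_mul (1 / 2)
    have h2 := ((tendsto_windowLength T hd).const_mul (2 * (T : ℝ) + 1)).add
      ((tendsto_pow_atTop_nhds_zero_of_lt_one hq0.le hq1).div_const (1 - q))
    have h3 := (((h1.add (h2.const_mul η)).add (hu0.const_mul (C / (2 * η)))).const_mul 4).div_const √ℓ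
    simp only [mul_zero, add_zero, zero_div] at h3
    exact h3
  refine tendsto_of_trapped ha hr0 hBt (K := K) fun K₀ hK₀ N hN hball => ?_
  have hrec : ∀ k ∈ Finset.Ico K₀ N, scaledStep Lk x (k + 1) ≤
      1 / 2 * scaledStep Lk x (lastUpdate b (b (k + 1)) k) +
      η * (∑ j ∈ Finset.Ico (k - 2 * T) (k + 1), dist (x j) (x (j + 1)) + q ^ k) +
      C / (2 * η) * (u k - u (k + 1)) := by
    intro k hk
    have hkK : K ≤ k := hK₀.le.trans (Finset.mem_Ico.1 hk).1
    have h1 := (hK k hkK).1 (hball k hk)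
    have h2 := h.descent hF.contDiff hlam hp hδ hμ.2 hF.pos k
    have h3 := h.reducedObjective_sub (hK k hkK).2.1 (hK (k + 1) (by omega)).2.1
    have h4 : 0 ≤ J (z k) - J (z (k + 1)) := by
      rw [h3]; exact sub_nonneg.2 (hdesc (Nat.le_succ k))
    exact le_of_sq_descent (scaledStep_nonneg _) (hA0 k).le hη0 hC
      (nonneg_of_mul_nonneg_right (h4.trans h1) (mul_pos hC (hA0 k)))
      (by rw [← h3] at h2; exact h2.trans h1)
  have hsum := sum_steps_le b (a := scaledStep Lk x) (δ := fun k => dist (x k) (x (k + 1)))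
    (u := u) (ζ := fun k => q ^ k) (η := η) (c := C / (2 * η)) (W := 2 * T)
    (fun k => scaledStep_nonneg k) (fun k => dist_nonneg)
    (fun k => by
      refine le_trans (le_of_eq ?_) (h.sqrt_mul_dist_le k)
      rw [hη]; push_cast; field_simp)
    (by positivity) (fun k hk => hu_nonneg k (hK₀.le.trans hk)) hη0.le hN hrec
  have h1 : ∑ j ∈ Finset.Ico (K₀ - 2 * T) K₀, dist (x j) (x (j + 1)) ≤ windowLength x T K₀ :=
    Finset.sum_le_sum_of_subset_of_nonneg (Finset.Ico_subset_Ico le_rfl (Nat.le_succ _))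
      fun _ _ _ => dist_nonneg
  have h2 : ∑ k ∈ Finset.Ico K₀ N, q ^ k ≤ q ^ K₀ / (1 - q) :=
    geom_sum_Ico_le_of_lt_one hq0.le hq1
  rw [hB, le_div_iff₀' hℓ0, Finset.mul_sum]
  refine (Finset.sum_le_sum fun k _ => h.sqrt_mul_dist_le k).trans (hsum.trans ?_)
  push_cast
  gcongr

end Algorithm

end BPIRE

theorem mainTheorem7 {n m : ℕ} (f : EuclideanSpace ℝ (Fin n) → ℝ) (blk : Fin n → Fin m)
    (lam p ℓ L δ μ : ℝ) (hlam : 0 < lam) (hp : 0 < p ∧ p < 1) (hδ : δ < 1) (hμ : 0 < μ ∧ μ < 1)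
    (hF : BPIRE.ProblemAssumption f blk lam p ℓ L)
    (b : ℕ → Fin m) (β Lk : ℕ → ℝ) (x : ℕ → EuclideanSpace ℝ (Fin n)) (ε : ℕ → Fin n → ℝ)
    (halg : BPIRE.IsBPIREeLp f blk lam p ℓ L δ μ b β Lk x ε)
    (T : ℕ) (hT : BPIRE.EssentiallyCyclic b T)
    (hdesc : ∀ k, BPIRE.objective f lam p (x (k + 1)) (ε (k + 1)) ≤
      BPIRE.objective f lam p (x k) (ε k))
    (xstar : EuclideanSpace ℝ (Fin n)) (hxstar : MapClusterPt xstar atTop x)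
    (ρ LG : ℝ) (hρ : 0 < ρ)
    (hLG : ∀ i, ∀ y ∈ Metric.ball xstar (4 * ρ), ∀ z ∈ Metric.ball xstar (4 * ρ),
      ‖BPIRE.blockPart blk i (gradient f y - gradient f z)‖ ≤ LG * ‖y - z‖)
    (hKL : BPIRE.HasKLProperty
      (BPIRE.reducedObjective f lam p (BPIRE.nonzeroIdx xstar))
      (BPIRE.reducedPoint (BPIRE.nonzeroIdx xstar) xstar)) :
    (∃ K, ∀ k > K, BPIRE.nonzeroIdx (x k) = BPIRE.nonzeroIdx xstar) ∧
      Tendsto x atTop (𝓝 xstar) := by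
  have hanti : Antitone fun k => BPIRE.objective f lam p (x k) (ε k) :=
    antitone_nat_of_succ_le hdesc
  have hd := halg.tendsto_dist hF.pos (halg.tendsto_scaledStep hF hlam hp hδ hμ.2 hanti)
  obtain ⟨R, hR, hxR⟩ := hF.exists_norm_le hlam hp.1 hanti
  obtain ⟨c, hc, hlow⟩ := halg.exists_lower_bound hF.contDiff hF.pos hlam hp hR hxR
  have hsupp := BPIRE.eventually_nonzeroIdx_eq (half_pos hc)
    (halg.eventually_eq_zero_or_le_abs hμ.2 hT hc hlow hd) hd hxstar
  refine ⟨?_, halg.tendsto_of_support hF hlam hp hδ hμ hT hanti hxstar hρ hLG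
    (fun j hj => by simpa [BPIRE.nonzeroIdx] using hj) hsupp hKL⟩
  obtain ⟨K, hK⟩ := eventually_atTop.1 hsupp
  exact ⟨K, fun k hk => hK k hk.le⟩
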